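/- **Setting.** Let $\varphi(x;w)=c^\top x^{(H)}$ be the feedforward network of depth $H\ge 1$ and width $m$ with $x^{(0)}=x\in\mathbb R^d$, $x^{(h)}=m^{-1/2}\sigma(W^{(h)}x^{(h-1)})$ for $1\le h\le H$ (with $\sigma$ applied entrywise), parameter vector $w=\mathrm{vec}(W^{(1)},\dots,W^{(H)},c)\in\mathbb R^p$ and twice continuously differentiable activation $\sigma$. Let $\mathcal C\subset\mathbb R^p$ be compact and convex with diameter at most $r_{\mathcal C}$, and let $\mathscr Z\subset\{(x,y)\in\mathbb R^d\times\mathbb R:\|x\|_2\le1,|y|\le1\}$. For every $z\in\mathscr Z$ let the loss $y'\mapsto\ell(y';z)$ be twice differentiable and $\nu$-strongly convex, with $\nu>0$. Put $K=[-R,R]$ with $R=\sup\{|\varphi(x;w)|:w\in\mathcal C,\|x\|_2\le1\}$, and let the constants $\mathrm{Lip}_{\ell}$, $L>0$, $\mathrm{Lip}_{\varphi}>0$ and $\mathrm{Lip}_{\nabla\varphi}\ge0$ be such that $|\ell'(y';z)|\le\mathrm{Lip}_{\ell}$ and $\ell''(y';z)\le L$ for $y'\in K$, $z\in\mathscr Z$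 (derivatives in $y'$), and $\|\nabla_w\varphi(x;w)\|_2\le\mathrm{Lip}_{\varphi}$ and $\|\nabla_w\varphi(x;w)-\nabla_w\varphi(x;w')\|_2\le\mathrm{Lip}_{\nabla\varphi}\|w-w'\|_2$ for $w,w'\in\mathcal C$, $\|x\|_2\le1$. Let $1\le B\le n$, and let $I_0,I_1,\dots$ be i.i.d. and uniform among the $B$-element subsets of $\{1,\dots,n\}$. For a training set $s=(z_j)_{j\le n}\in\mathscr Z^n$, $z_j=(x_j,y_j)$, put $J_k(w)=[\nabla_w^\top\varphi(x_j;w)]_{j\in I_k}$, $G_k(w)=[\ell'(\varphi(x_j;w);z_j)]_{j\in I_k}$, $\Psi_k(w)=J_k(w)^\top G_k(w)$. The stochastic Gauss–Newton method (SGN) with $\eta,\alpha,\lambda>0$ starts at $w_0\in\mathcal C$ and iterates $$H_k=\alpha\sum_{t=0}^kJ_t(w_t)^\top J_t(w_t)+\lambda I,\qquad w_{k+1}=\operatorname*{arg\,min}_{u\in\mathcal C}\big\|u-\big(w_k-\eta H_k^{-1}\Psi_k(w_k)\big)\big\|_{H_k},$$ where $\|v\|_M=\sqrt{v^\top Mv}$.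 Let $s,s'\in\mathscr Z^n$ differ in exactly one sample; let $(w_k,H_k)$ and $(w_k',H_k')$ be the SGN runs on $s$ and $s'$ with the same $w_0$ and the same minibatches; put $\Delta_k=w_k-w_k'$, $\bar H_k=\frac12(H_k+H_k')$, $\widehat w_k=\frac1k\sum_{t<k}w_t$, $\widehat w_k'=\frac1k\sum_{t<k}w_t'$. **Theorem (uniform stability of SGN).** Assume that, for some $\mu_0>0$, the Jacobian $J(w)=[\nabla_w^\top\varphi(x_j;w)]_{j\le n}$ for $s$ satisfies $J(w)J(w)^\top\succeq\mu_0^2I$ for all $w\in\mathcal C$. Let $$\varepsilon=B\,\mathrm{Lip}_{\ell}\,\mathrm{Lip}_{\nabla\varphi},\qquad\Lambda=B\,L\,\mathrm{Lip}_{\varphi}^2+\varepsilon,$$ and assume $$\frac\eta\lambda\le\frac1\Lambda,\qquad\frac\alpha\eta\le\frac{\mu_0^2\nu^2}{8B(\Lambda+\varepsilon)}.$$ Let $\lambda_t>0$, $t\in\mathbb N$, be such that $\lambda_{\min}(H_t)\ge\lambda_t$ almost surely for all $t$. Then there is a constant $K_0$, which depends only on $r_{\mathcal C},\mathrm{Lip}_{\varphi},\mathrm{Lip}_{\ell},L,\mu_0,\nu$,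 such that for every $k\ge1$ one has $\mathbb E\|\Delta_k\|_{\bar H_{k-1}}\le K_0\,b_k$, where $$b_k=k\sqrt{\eta B\,\mathrm{Lip}_{\nabla\varphi}}+k\sqrt\alpha\,B^{3/2}\,\mathrm{Lip}_{\nabla\varphi}+\alpha B^2\Big(\mathrm{Lip}_{\nabla\varphi}+\frac1n\Big)\sum_{t=0}^{k-1}\frac{t+1}{\lambda_t^{1/2}}+\frac{\eta B}n\sum_{t=0}^{k-1}\lambda_t^{-1/2}.$$ Consequently, SGN is uniformly stable: for every $z=(x,y)\in\mathscr Z$ and $k\ge1$, $$\mathbb E\big|\ell(\varphi(x;\widehat w_k);z)-\ell(\varphi(x;\widehat w_k');z)\big|\le\frac{\mathrm{Lip}_{\ell}\,\mathrm{Lip}_{\varphi}}{\sqrt\lambda}\,K_0\,b_k.$$ -/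

import Mathlib

open MeasureTheory ProbabilityTheory
open scoped Matrix BigOperators ENNReal

namespace SGN

noncomputable section

/-! ### The feedforward network -/

/-- Width of the `h`-th layer: the input layer has width `d`, every further layer has width `m`. -/
def layerWidth (d m : ℕ) : ℕ → ℕ
  | 0 => d
  | _ + 1 => m

/-- Coordinates of the parameter vector `w = vec (W⁽¹⁾, …, W⁽ᴴ⁾, c)`: the entries of the weight
matrices (`W⁽ʰ⁺¹⁾` has `m` rows and `layerWidth d m h` columns) and those of the output vector `c`
(which has `m` entries as soon as `1 ≤ H`). -/
abbrev ParamIdx (d m H : ℕ) : Type :=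
  (Σ h : Fin H, Fin m × Fin (layerWidth d m h)) ⊕ Fin (layerWidth d m H)

/-- The parameter space `ℝᵖ` with its Euclidean norm. -/
abbrev Param (d m H : ℕ) : Type := EuclideanSpace ℝ (ParamIdx d m H)

/-- The space `ℝᵈ × ℝ` of input-output pairs `z = (x, y)`. -/
abbrev Sample (d : ℕ) : Type := EuclideanSpace ℝ (Fin d) × ℝ

variable {d m H : ℕ}

/-- The hidden layers: `x⁽⁰⁾ = x` and `x⁽ʰ⁺¹⁾ = m^(-1/2) σ (W⁽ʰ⁺¹⁾ x⁽ʰ⁾)` entrywise. -/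
def features (σ : ℝ → ℝ) (x : EuclideanSpace ℝ (Fin d)) (w : Param d m H) :
    (h : ℕ) → h ≤ H → Fin (layerWidth d m h) → ℝ
  | 0, _ => fun i => x i
  | h + 1, hh => fun i =>
      1 / √(m : ℝ) *
        σ (∑ j, w (Sum.inl ⟨⟨h, hh⟩, i, j⟩) * features σ x w h (Nat.le_of_succ_le hh) j)

/-- The predictor `φ(x; w) = cᵀ x⁽ᴴ⁾`. -/
def predictor (σ : ℝ → ℝ) (x : EuclideanSpace ℝ (Fin d)) (w : Param d m H) : ℝ :=
  ∑ i, w (Sum.inr i) * features σ x w H le_rfl i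

/-- `sup |φ(x; w)|` over `w ∈ C` and `‖x‖ ≤ 1`. -/
def predictionRadius (σ : ℝ → ℝ) (C : Set (Param d m H)) : ℝ :=
  sSup {a | ∃ x : EuclideanSpace ℝ (Fin d), ‖x‖ ≤ 1 ∧ ∃ w ∈ C, a = |predictor σ x w|}

/-- The compact interval that contains all predictions for `w ∈ C` and `‖x‖ ≤ 1`. -/
def predictionRange (σ : ℝ → ℝ) (C : Set (Param d m H)) : Set ℝ :=
  Set.Icc (-predictionRadius σ C) (predictionRadius σ C)

/-! ### Loss, Jacobians, gradients -/

/-- For every sample `z ∈ Z`, the loss `y' ↦ ℓ(y'; z)` is twice differentiable and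
`ν`-strongly convex. -/
structure IsRegularLoss (ℓ : ℝ → Sample d → ℝ) (Z : Set (Sample d)) (ν : ℝ) : Prop where
  differentiable : ∀ z ∈ Z, Differentiable ℝ (fun y => ℓ y z)
  differentiable_deriv : ∀ z ∈ Z, Differentiable ℝ (deriv fun y => ℓ y z)
  strongConvex : ∀ z ∈ Z, StrongConvexOn Set.univ ν (fun y => ℓ y z)

/-- The Jacobian of the predictor: row `j` is `∇_w φ(x_j; w)ᵀ`, for a family of samples
`z_j = (x_j, y_j)`. -/
def jacobian (σ : ℝ → ℝ) {ι : Type} (s : ι → Sample d) (w : Param d m H) :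
    Matrix ι (ParamIdx d m H) ℝ :=
  Matrix.of fun j i => gradient (predictor σ (s j).1) w i

/-- The vector of the derivatives `ℓ'(φ(x_j; w); z_j)`. -/
def lossDeriv (σ : ℝ → ℝ) (ℓ : ℝ → Sample d → ℝ) {ι : Type} (s : ι → Sample d)
    (w : Param d m H) : ι → ℝ :=
  fun j => deriv (fun y => ℓ y (s j)) (predictor σ (s j).1 w)

/-- The samples of the training set `s` with index in the minibatch `I`. -/
def batch {n : ℕ} (s : Fin n → Sample d) (I : Finset (Fin n)) : I → Sample d :=
  fun j => s j

/-- The minibatch gradient `Ψ(w) = J(w)ᵀ G(w)`. -/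
def batchGradient (σ : ℝ → ℝ) (ℓ : ℝ → Sample d → ℝ) {n : ℕ} (s : Fin n → Sample d)
    (I : Finset (Fin n)) (w : Param d m H) : Param d m H :=
  WithLp.toLp 2 ((jacobian σ (batch s I) w)ᵀ *ᵥ lossDeriv σ ℓ (batch s I) w)

/-! ### The stochastic Gauss-Newton method -/

/-- `‖v‖_M = √(vᵀ M v)`. -/
def metricNorm (M : Matrix (ParamIdx d m H) (ParamIdx d m H) ℝ) (v : Param d m H) : ℝ :=
  √(v.ofLp ⬝ᵥ (M *ᵥ v.ofLp))

/-- The projection onto `C` in the metric `M`: a point of `C` that minimizes `‖v - u‖_M`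
over `v ∈ C` (unique for nonempty compact convex `C` and positive definite `M`). -/
def metricProj (C : Set (Param d m H)) (M : Matrix (ParamIdx d m H) (ParamIdx d m H) ℝ)
    (u : Param d m H) : Param d m H :=
  Classical.epsilon fun v => v ∈ C ∧ ∀ v' ∈ C, metricNorm M (v - u) ≤ metricNorm M (v' - u)

section Algorithm

variable (σ : ℝ → ℝ) (ℓ : ℝ → Sample d → ℝ) (C : Set (Param d m H)) (η α lam : ℝ)
  (w₀ : Param d m H) {n : ℕ} (s : Fin n → Sample d) (I : ℕ → Finset (Fin n))

/-- The pair `(w_k, H_{k-1})`, with the convention `H_{-1} = λ 1`, along the minibatches `I`. -/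
def state : ℕ → Param d m H × Matrix (ParamIdx d m H) (ParamIdx d m H) ℝ
  | 0 => (w₀, lam • 1)
  | k + 1 =>
      let w := (state k).1
      let J := jacobian σ (batch s (I k)) w
      let M := (state k).2 + α • (Jᵀ * J)
      (metricProj C M (w - η • WithLp.toLp 2 (M⁻¹ *ᵥ (batchGradient σ ℓ s (I k) w).ofLp)), M)

/-- The iterate `w_k`. -/
def iterate (k : ℕ) : Param d m H := (state σ ℓ C η α lam w₀ s I k).1

/-- The preconditioner `H_k`. -/
def precond (k : ℕ) : Matrix (ParamIdx d m H) (ParamIdx d m H) ℝ :=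
  (state σ ℓ C η α lam w₀ s I (k + 1)).2

/-- `H_k = α ∑_{t ≤ k} J_t(w_t)ᵀ J_t(w_t) + λ 1`. -/
theorem precond_eq (k : ℕ) :
    precond σ ℓ C η α lam w₀ s I k =
      α • ∑ t ∈ Finset.range (k + 1),
        (jacobian σ (batch s (I t)) (iterate σ ℓ C η α lam w₀ s I t))ᵀ *
          jacobian σ (batch s (I t)) (iterate σ ℓ C η α lam w₀ s I t) + lam • 1 := by
  induction k with
  | zero => simp [precond, state, iterate, add_comm]
  | succ k ih =>
    rw [Finset.sum_range_succ, smul_add, add_right_comm, ← ih]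
    rfl

/-- `w_{k+1}` is the `H_k`-projection of `w_k - η H_k⁻¹ Ψ_k(w_k)`. -/
theorem iterate_succ (k : ℕ) :
    iterate σ ℓ C η α lam w₀ s I (k + 1) =
      metricProj C (precond σ ℓ C η α lam w₀ s I k)
        (iterate σ ℓ C η α lam w₀ s I k - η • WithLp.toLp 2
          ((precond σ ℓ C η α lam w₀ s I k)⁻¹ *ᵥ
            (batchGradient σ ℓ s (I k) (iterate σ ℓ C η α lam w₀ s I k)).ofLp)) := rfl

/-- The average iterate `(1/k) ∑_{t < k} w_t`. -/
def avgIterate (k : ℕ) : Param d m H :=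
  (1 / (k : ℝ)) • ∑ t ∈ Finset.range k, iterate σ ℓ C η α lam w₀ s I t

/-- `‖w_k - w_k'‖` in the midpoint metric `(H_{k-1} + H_{k-1}') / 2`, for the runs on the training
sets `s` and `s'` with the same minibatches and the same starting point (meant for `1 ≤ k`). -/
def midpointDist (s' : Fin n → Sample d) (k : ℕ) : ℝ :=
  metricNorm ((1 / 2 : ℝ) • (precond σ ℓ C η α lam w₀ s I (k - 1) +
      precond σ ℓ C η α lam w₀ s' I (k - 1)))
    (iterate σ ℓ C η α lam w₀ s I k - iterate σ ℓ C η α lam w₀ s' I k)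

end Algorithm

/-- The minibatches are i.i.d., uniform among the subsets of `{1, …, n}` with `B` elements. -/
structure IsUniformBatchProcess {Ω : Type*} [MeasurableSpace Ω] (μ : Measure Ω) {n : ℕ} (B : ℕ)
    (I : ℕ → Ω → Finset (Fin n)) : Prop where
  measurable : ∀ k M, MeasurableSet {ω | I k ω = M}
  law : ∀ k M, M.card = B → μ {ω | I k ω = M} = (n.choose B : ℝ≥0∞)⁻¹
  indep : iIndepFun (m := fun _ => ⊤) I μ

/-- The right-hand side of the stability bound: approximate non-expansivity, preconditioner
mismatch, gradient mismatch. `Lg` is the Lipschitz constant of `∇φ`, and `ls` the sequence of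
lower bounds on the preconditioners. -/
def stabilityBound (B n : ℕ) (η α Lg : ℝ) (ls : ℕ → ℝ) (k : ℕ) : ℝ :=
  (k * √(η * B * Lg) + k * √α * (B : ℝ) ^ (3 / 2 : ℝ) * Lg)
    + α * (B : ℝ) ^ 2 * (Lg + 1 / n) * ∑ t ∈ Finset.range k, ((t : ℝ) + 1) / √(ls t)
    + η * B / n * ∑ t ∈ Finset.range k, 1 / √(ls t)

end

end SGN

/-! ### Coercivity of the Gauss-Newton gradient gap -/

namespace SGN

/-! The two runs are compared in the midpoint metric. Each projection satisfies a variational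
inequality in which `H_k⁻¹` cancels against `H_k`, so that only the Euclidean gradient remains.
Testing each inequality with the new point of the other run and adding gives a bound on `‖Δ_{k+1}‖²`
in the metric `H̄_k`; with the midpoint metric, the discrepancy `H_k - H_k'` enters only through
half its pairing of the summed displacements with `Δ_{k+1}` (`midpoint_sq_step`).

The gradient difference splits into `p`, the difference for the one training set `s` at the two
parameters, plus the contribution of the changed sample. Let `S = ∑ (G_j - G_j') (φ_j - φ_j')`, and
neglect for a moment the nonlinearity of the model in `w`. Updating the metric by `α JᵀJ` costs at
most `ηS` (strong monotonicity of `ℓ'` and `2α ≤ ην`). Replacing `Δ_{k+1}` by `Δ_k` in the pairing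
with `p` costs `η²‖p‖²/λ ≤ ηS` (cocoercivity and `η/λ ≤ 1/Λ`). The pairing itself gains `2ηS`. So
`S` cancels, and nonlinearity leaves an additive defect of order `ηε r² + αB Lg² r⁴`
(`gradient_gap_coercive`). The step is thus approximately non-expansive: errors add up and are not
amplified.

The remaining terms are linear in `‖Δ_{k+1}‖`, which `H_k ⪰ λ_k` controls by the midpoint norm.
Solving the quadratic inequality (`le_add_sqrt_of_sq_le`) turns it into a recursion for the distance
itself (`stateDist_succ_le`). Each past minibatch contributes to `H_k - H_k'` a part proportional to
`αB Lg`, and a part proportional to `α` if it contains the changed sample, which has probability at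
most `B/n`. In expectation the increments are therefore bounded by those of `b_k` (`increment_le`).
The loss bound follows from `H_k ⪰ λ`, the Lipschitz bounds on the convex set `C`, and the
monotonicity of `b_k`. -/

/-- Coercivity of the difference of two Gauss-Newton gradients, up to the curvature of the model. -/
theorem gradient_gap_coercive {E ι : Type*} [NormedAddCommGroup E] [InnerProductSpace ℝ E]
    (I : Finset ι) (B : ℕ) (hB : I.card = B) (g g' : ι → E) (G G' δ : ι → ℝ) (Δ p : E)
    {Lφ Lℓ L Lg ν η α lam ε Λ : ℝ} (hLφ : 0 < Lφ) (hLℓ : 0 ≤ Lℓ) (hL : 0 < L) (hLg : 0 ≤ Lg)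
    (hη : 0 < η) (hα : 0 < α) (hB1 : 1 ≤ B)
    (hε : ε = B * Lℓ * Lg) (hΛ : Λ = B * L * Lφ ^ 2 + ε) (hηΛ : η / lam ≤ 1 / Λ)
    (hαη : 2 * α ≤ η * ν)
    (hg : ∀ j ∈ I, ‖g j‖ ≤ Lφ) (hgg' : ∀ j ∈ I, ‖g j - g' j‖ ≤ Lg * ‖Δ‖)
    (hgδ : ∀ j ∈ I, |inner ℝ (g j) Δ - δ j| ≤ Lg * ‖Δ‖ ^ 2)
    (hg'δ : ∀ j ∈ I, |inner ℝ (g' j) Δ - δ j| ≤ Lg * ‖Δ‖ ^ 2)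
    (hG : ∀ j ∈ I, |G j| ≤ Lℓ) (hG' : ∀ j ∈ I, |G' j| ≤ Lℓ)
    (hmono : ∀ j ∈ I, ν * δ j ^ 2 ≤ (G j - G' j) * δ j)
    (hcoco : ∀ j ∈ I, (G j - G' j) ^ 2 ≤ L * ((G j - G' j) * δ j))
    (hp : p = ∑ j ∈ I, (G j • g j - G' j • g' j)) :
    α / 2 * ∑ j ∈ I, (inner ℝ (g j) Δ ^ 2 + inner ℝ (g' j) Δ ^ 2) - 2 * η * inner ℝ p Δ
        + η ^ 2 / lam * ‖p‖ ^ 2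
      ≤ 5 * (η * ε) * ‖Δ‖ ^ 2 + 2 * α * B * Lg ^ 2 * ‖Δ‖ ^ 4 := by
  set S : ℝ := ∑ j ∈ I, (G j - G' j) * δ j with hS
  have hBpos : (0 : ℝ) < B := by exact_mod_cast hB1
  have hε0 : 0 ≤ ε := by rw [hε]; positivity
  have hΛ0 : 0 < Λ := by rw [hΛ]; positivity
  have hS0 : 0 ≤ S := Finset.sum_nonneg fun j hj => by
    have := hcoco j hj
    have h2 := sq_nonneg (G j - G' j)
    by_contra! h
    nlinarith
  have hinner : S - 2 * ε * ‖Δ‖ ^ 2 ≤ inner ℝ p Δ := by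
    have hc : 2 * ε * ‖Δ‖ ^ 2 = ∑ _j ∈ I, 2 * Lℓ * (Lg * ‖Δ‖ ^ 2) := by
      rw [Finset.sum_const, hB, hε, nsmul_eq_mul]; ring
    rw [hp, sum_inner, hc, hS, ← Finset.sum_sub_distrib]
    refine Finset.sum_le_sum fun j hj => ?_
    rw [inner_sub_left, real_inner_smul_left, real_inner_smul_left]
    have h1 : |G j * (inner ℝ (g j) Δ - δ j)| ≤ Lℓ * (Lg * ‖Δ‖ ^ 2) := by
      rw [abs_mul]; exact mul_le_mul (hG j hj) (hgδ j hj) (abs_nonneg _) hLℓ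
    have h2 : |G' j * (inner ℝ (g' j) Δ - δ j)| ≤ Lℓ * (Lg * ‖Δ‖ ^ 2) := by
      rw [abs_mul]; exact mul_le_mul (hG' j hj) (hg'δ j hj) (abs_nonneg _) hLℓ
    have h3 := (abs_le.1 h1).1
    have h4 := (abs_le.1 h2).2
    nlinarith
  have hnorm : ‖p‖ ^ 2 ≤ Λ * S + Λ * ε * ‖Δ‖ ^ 2 := by
    set a : ℝ := ‖∑ j ∈ I, (G j - G' j) • g j‖ with ha
    have hpab : ‖p‖ ≤ a + ε * ‖Δ‖ := by
      -- The first sum is driven by the slopes and is controlled by `S`; the second one vanishes for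
      -- a model linear in the parameters.
      have : p = ∑ j ∈ I, (G j - G' j) • g j + ∑ j ∈ I, G' j • (g j - g' j) := by
        rw [hp, ← Finset.sum_add_distrib]
        refine Finset.sum_congr rfl fun j _ => ?_
        rw [sub_smul, smul_sub]; abel
      rw [this]
      refine (norm_add_le _ _).trans (add_le_add le_rfl ?_)
      refine (norm_sum_le _ _).trans ?_
      have hc : ε * ‖Δ‖ = ∑ _j ∈ I, Lℓ * (Lg * ‖Δ‖) := by
        rw [Finset.sum_const, hB, hε, nsmul_eq_mul]; ring
      rw [hc]
      refine Finset.sum_le_sum fun j hj => ?_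
      rw [norm_smul]
      exact mul_le_mul (hG' j hj) (hgg' j hj) (norm_nonneg _) hLℓ
    -- Cauchy-Schwarz over the `B` samples, then cocoercivity: `Λ - ε = B L Lφ²`.
    have ha2 : a ^ 2 ≤ (Λ - ε) * S := by
      have h1 : a ≤ (∑ j ∈ I, |G j - G' j|) * Lφ := by
        refine (norm_sum_le _ _).trans ?_
        rw [Finset.sum_mul]
        refine Finset.sum_le_sum fun j hj => ?_
        rw [norm_smul]
        exact mul_le_mul_of_nonneg_left (hg j hj) (abs_nonneg _)
      have h2 : (∑ j ∈ I, |G j - G' j|) ^ 2 ≤ B * ∑ j ∈ I, (G j - G' j) ^ 2 := by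
        have := sq_sum_le_card_mul_sum_sq (s := I) (f := fun j => |G j - G' j|)
        simpa [hB] using this
      have h3 : ∑ j ∈ I, (G j - G' j) ^ 2 ≤ L * S := by
        rw [hS, Finset.mul_sum]; exact Finset.sum_le_sum hcoco
      calc a ^ 2 ≤ ((∑ j ∈ I, |G j - G' j|) * Lφ) ^ 2 :=
            pow_le_pow_left₀ (norm_nonneg _) h1 2
        _ = (∑ j ∈ I, |G j - G' j|) ^ 2 * Lφ ^ 2 := by ring
        _ ≤ (B * (L * S)) * Lφ ^ 2 := by
            gcongr
            exact h2.trans (mul_le_mul_of_nonneg_left h3 hBpos.le)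
        _ = (Λ - ε) * S := by rw [hΛ]; ring
    -- AM-GM for the factors `εS` and `(Λ - ε)ε‖Δ‖²`, weighted so that the coefficients in `hnorm`
    -- add up to exactly `Λ`.
    have hcross : 2 * (a * (ε * ‖Δ‖)) ≤ ε * S + (Λ - ε) * ε * ‖Δ‖ ^ 2 := by
      have hΛε : 0 ≤ Λ - ε := by rw [hΛ]; ring_nf; positivity
      refine abs_le_of_sq_le_sq' ?_ (by positivity) |>.2
      have h1 : a ^ 2 * (ε * ‖Δ‖) ^ 2 ≤ (Λ - ε) * S * (ε * ‖Δ‖) ^ 2 :=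
        mul_le_mul_of_nonneg_right ha2 (sq_nonneg _)
      nlinarith [sq_nonneg (ε * S - (Λ - ε) * ε * ‖Δ‖ ^ 2)]
    calc ‖p‖ ^ 2 ≤ (a + ε * ‖Δ‖) ^ 2 := pow_le_pow_left₀ (norm_nonneg _) hpab 2
      _ ≤ Λ * S + Λ * ε * ‖Δ‖ ^ 2 := by nlinarith
  have hquad : η ^ 2 / lam * ‖p‖ ^ 2 ≤ η * S + η * ε * ‖Δ‖ ^ 2 := by
    have h1 : η ^ 2 / lam * ‖p‖ ^ 2 ≤ η * (1 / Λ) * (Λ * S + Λ * ε * ‖Δ‖ ^ 2) := by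
      have h0 : η ^ 2 / lam = η * (η / lam) := by ring
      rw [h0]
      gcongr
    refine h1.trans (le_of_eq ?_)
    field_simp
  have hjac : α / 2 * ∑ j ∈ I, (inner ℝ (g j) Δ ^ 2 + inner ℝ (g' j) Δ ^ 2)
      ≤ η * S + 2 * α * B * Lg ^ 2 * ‖Δ‖ ^ 4 := by
    have hc : 2 * α * B * Lg ^ 2 * ‖Δ‖ ^ 4 = ∑ _j ∈ I, 2 * α * (Lg * ‖Δ‖ ^ 2) ^ 2 := by
      rw [Finset.sum_const, hB, nsmul_eq_mul]; ring
    rw [hc, hS, Finset.mul_sum, Finset.mul_sum, ← Finset.sum_add_distrib]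
    refine Finset.sum_le_sum fun j hj => ?_
    have key : ∀ x : ℝ, |x - δ j| ≤ Lg * ‖Δ‖ ^ 2 →
        x ^ 2 ≤ 2 * δ j ^ 2 + 2 * (Lg * ‖Δ‖ ^ 2) ^ 2 := fun x hx => by
      have h1 : (x - δ j) ^ 2 ≤ (Lg * ‖Δ‖ ^ 2) ^ 2 := sq_le_sq' (abs_le.1 hx).1 (abs_le.1 hx).2
      nlinarith [sq_nonneg (x - 2 * δ j)]
    have h1 := key _ (hgδ j hj)
    have h2 := key _ (hg'δ j hj)
    have h3 : 2 * α * δ j ^ 2 ≤ η * ((G j - G' j) * δ j) :=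
      calc 2 * α * δ j ^ 2 ≤ η * ν * δ j ^ 2 := by gcongr
        _ = η * (ν * δ j ^ 2) := by ring
        _ ≤ _ := mul_le_mul_of_nonneg_left (hmono j hj) hη.le
    have h4 := mul_le_mul_of_nonneg_left (add_le_add h1 h2) (half_pos hα).le
    nlinarith
  -- The two terms `ηS` from `hjac` and `hquad` are consumed by `-2ηS`; the constant is `5 = 4 + 1`,
  -- from `hinner` and `hquad`.
  nlinarith [mul_le_mul_of_nonneg_left hinner hη.le]

end SGN

/-! ### One step in the midpoint metric -/

namespace SGN

/-- One step of two preconditioned projected gradient methods with different metrics: the squared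
distance in the midpoint metric grows by the coercivity defect `β` and by terms that are linear in
the new distance. -/
theorem midpoint_sq_step {E ι : Type*} [NormedAddCommGroup E] [InnerProductSpace ℝ E]
    [DecidableEq ι] (I : Finset ι) (i₀ : ι) (P P' M M' : E →ₗ[ℝ] E →ₗ[ℝ] ℝ)
    (g g' h : ι → E) (w w' w₁ w₁' ψ ψ' p : E) {lam η α Lφ β q D : ℝ}
    (hlam : 0 < lam) (hη : 0 < η) (hα : 0 < α)
    (hPs : ∀ u v, P u v = P v u) (hPs' : ∀ u v, P' u v = P' v u)
    (hP : ∀ v, lam * ‖v‖ ^ 2 ≤ P v v) (hP' : ∀ v, lam * ‖v‖ ^ 2 ≤ P' v v)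
    (hM : ∀ u v, M u v = P u v + α * ∑ j ∈ I, inner ℝ (g j) u * inner ℝ (g j) v)
    (hM' : ∀ u v, M' u v = P' u v + α * ∑ j ∈ I, inner ℝ (h j) u * inner ℝ (h j) v)
    (hh : ∀ j ∈ I, j ≠ i₀ → h j = g' j) (hhL : ∀ j ∈ I, ‖h j‖ ≤ Lφ)
    (hvar : 0 ≤ M (w₁ - w) (w₁' - w₁) + η * inner ℝ ψ (w₁' - w₁))
    (hvar' : 0 ≤ M' (w₁' - w') (w₁ - w₁') + η * inner ℝ ψ' (w₁ - w₁'))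
    (hq : ‖ψ - ψ' - p‖ ≤ q)
    (hD : ∀ u v, |M u v - M' u v| ≤ D * ‖u‖ * ‖v‖)
    (hβ : α / 2 * ∑ j ∈ I, (inner ℝ (g j) (w - w') ^ 2 + inner ℝ (g' j) (w - w') ^ 2)
        - 2 * η * inner ℝ p (w - w') + η ^ 2 / lam * ‖p‖ ^ 2 ≤ β) :
    (M (w₁ - w₁') (w₁ - w₁') + M' (w₁ - w₁') (w₁ - w₁')) / 2
      ≤ (P (w - w') (w - w') + P' (w - w') (w - w')) / 2 + β
        + 2 * (α / 2 * Lφ ^ 2 * ‖w - w'‖ * (if i₀ ∈ I then 1 else 0) + η * q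
          + D / 2 * ‖(w₁ - w) + (w₁' - w')‖) * ‖w₁ - w₁'‖ := by
  set Δ := w - w' with hΔ
  set Δ₁ := w₁ - w₁' with hΔ₁
  set a := w₁ - w with ha
  set b := w₁' - w' with hb
  have hab : a - b = Δ₁ - Δ := by rw [ha, hb, hΔ₁, hΔ]; abel
  have hneg : w₁' - w₁ = -Δ₁ := by rw [hΔ₁]; abel
  -- The term `-lam * ‖Δ - Δ₁‖ ^ 2` is kept: it pays for the exchange of `Δ₁` and `Δ` in `hyoung`.
  have hPab : ∀ T : E →ₗ[ℝ] E →ₗ[ℝ] ℝ, (∀ u v, T u v = T v u) → (∀ v, lam * ‖v‖ ^ 2 ≤ T v v) →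
      2 * T Δ Δ₁ ≤ T Δ Δ + T Δ₁ Δ₁ - lam * ‖Δ - Δ₁‖ ^ 2 := fun T hs hT => by
    have := hT (Δ - Δ₁)
    simp only [map_sub, LinearMap.sub_apply] at this
    linarith [hs Δ Δ₁]
  have h1 := hPab P hPs hP
  have h2 := hPab P' hPs' hP'
  have h3 : 2 * ∑ j ∈ I, inner ℝ (g j) Δ * inner ℝ (g j) Δ₁
      ≤ ∑ j ∈ I, inner ℝ (g j) Δ ^ 2 + ∑ j ∈ I, inner ℝ (g j) Δ₁ * inner ℝ (g j) Δ₁ := by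
    rw [Finset.mul_sum, ← Finset.sum_add_distrib]
    exact Finset.sum_le_sum fun j _ => by
      nlinarith [sq_nonneg (inner ℝ (g j) Δ - inner ℝ (g j) Δ₁)]
  -- Away from `i₀` this is the same estimate as `h3`; the sample `i₀` is bounded bluntly, with one
  -- factor `‖Δ₁‖` so that its cost stays linear in the new distance.
  have h4 : 2 * ∑ j ∈ I, inner ℝ (h j) Δ * inner ℝ (h j) Δ₁
      ≤ ∑ j ∈ I, inner ℝ (g' j) Δ ^ 2 + ∑ j ∈ I, inner ℝ (h j) Δ₁ * inner ℝ (h j) Δ₁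
        + 2 * (Lφ ^ 2 * ‖Δ‖ * ‖Δ₁‖) * (if i₀ ∈ I then 1 else 0) := by
    have hc : 2 * (Lφ ^ 2 * ‖Δ‖ * ‖Δ₁‖) * (if i₀ ∈ I then (1 : ℝ) else 0)
        = ∑ j ∈ I, if j = i₀ then 2 * (Lφ ^ 2 * ‖Δ‖ * ‖Δ₁‖) else 0 := by
      rw [Finset.sum_ite_eq']; split_ifs <;> simp
    rw [hc, Finset.mul_sum, ← Finset.sum_add_distrib, ← Finset.sum_add_distrib]
    refine Finset.sum_le_sum fun j hj => ?_
    split_ifs with hji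
    · have e1 : |inner ℝ (h j) Δ| ≤ Lφ * ‖Δ‖ := (abs_real_inner_le_norm _ _).trans
        (mul_le_mul_of_nonneg_right (hhL j hj) (norm_nonneg _))
      have e2 : |inner ℝ (h j) Δ₁| ≤ Lφ * ‖Δ₁‖ := (abs_real_inner_le_norm _ _).trans
        (mul_le_mul_of_nonneg_right (hhL j hj) (norm_nonneg _))
      have e3 : inner ℝ (h j) Δ * inner ℝ (h j) Δ₁ ≤ (Lφ * ‖Δ‖) * (Lφ * ‖Δ₁‖) := by
        refine (le_abs_self _).trans ?_
        rw [abs_mul]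
        exact mul_le_mul e1 e2 (abs_nonneg _) ((abs_nonneg _).trans e1)
      nlinarith [sq_nonneg (inner ℝ (g' j) Δ), mul_self_nonneg (inner ℝ (h j) Δ₁)]
    · rw [hh j hj hji]
      nlinarith [sq_nonneg (inner ℝ (g' j) Δ - inner ℝ (g' j) Δ₁)]
  -- Half-sum and half-difference of the forms, with `a - b = Δ₁ - Δ`.
  have hMab : M a Δ₁ - M' b Δ₁
      = (M Δ₁ Δ₁ + M' Δ₁ Δ₁) / 2 - (M Δ Δ₁ + M' Δ Δ₁) / 2
        + (M (a + b) Δ₁ - M' (a + b) Δ₁) / 2 := by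
    have e1 : M (a - b) Δ₁ = M Δ₁ Δ₁ - M Δ Δ₁ := by rw [hab]; simp
    have e2 : M' (a - b) Δ₁ = M' Δ₁ Δ₁ - M' Δ Δ₁ := by rw [hab]; simp
    simp only [map_sub, map_add, LinearMap.sub_apply, LinearMap.add_apply] at e1 e2 ⊢
    linarith
  have hvars : M a Δ₁ - M' b Δ₁ + η * inner ℝ (ψ - ψ') Δ₁ ≤ 0 := by
    rw [hneg] at hvar
    simp only [map_neg, inner_neg_right] at hvar
    rw [inner_sub_left]
    linarith
  have hDab : -(D * ‖a + b‖ * ‖Δ₁‖) ≤ M (a + b) Δ₁ - M' (a + b) Δ₁ := (abs_le.1 (hD _ _)).1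
  have hψ : inner ℝ (p) Δ₁ - q * ‖Δ₁‖ ≤ inner ℝ (ψ - ψ') Δ₁ := by
    have e1 : inner ℝ (ψ - ψ') Δ₁ = inner ℝ p Δ₁ + inner ℝ (ψ - ψ' - p) Δ₁ := by
      rw [← inner_add_left]; congr 1; abel
    have e2 : |inner ℝ (ψ - ψ' - p) Δ₁| ≤ q * ‖Δ₁‖ := (abs_real_inner_le_norm _ _).trans
        (mul_le_mul_of_nonneg_right hq (norm_nonneg _))
    rw [e1]; linarith [(abs_le.1 e2).1]
  have hyoung : 2 * η * inner ℝ p (Δ - Δ₁) ≤ η ^ 2 / lam * ‖p‖ ^ 2 + lam * ‖Δ - Δ₁‖ ^ 2 := by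
    have e1 : inner ℝ p (Δ - Δ₁) ≤ ‖p‖ * ‖Δ - Δ₁‖ := real_inner_le_norm _ _
    have e2 : 0 ≤ (η * ‖p‖ - lam * ‖Δ - Δ₁‖) ^ 2 / lam := by positivity
    have e3 : (η * ‖p‖ - lam * ‖Δ - Δ₁‖) ^ 2 / lam = η ^ 2 / lam * ‖p‖ ^ 2
        + lam * ‖Δ - Δ₁‖ ^ 2 - 2 * η * (‖p‖ * ‖Δ - Δ₁‖) := by field_simp; ring
    nlinarith
  rw [inner_sub_right] at hyoung
  rw [Finset.sum_add_distrib] at hβ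
  have hηψ := mul_le_mul_of_nonneg_left hψ hη.le
  have h34 := mul_le_mul_of_nonneg_left (add_le_add h3 h4) hα.le
  have e1 := hM Δ Δ₁
  have e2 := hM' Δ Δ₁
  have e3 := hM Δ₁ Δ₁
  have e4 := hM' Δ₁ Δ₁
  -- What is left is linear in these sums and in the products already bounded.
  generalize (∑ j ∈ I, inner ℝ (g j) Δ * inner ℝ (g j) Δ₁) = x1 at *
  generalize (∑ j ∈ I, inner ℝ (h j) Δ * inner ℝ (h j) Δ₁) = x2 at *
  generalize (∑ j ∈ I, inner ℝ (g j) Δ₁ * inner ℝ (g j) Δ₁) = x3 at *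
  generalize (∑ j ∈ I, inner ℝ (h j) Δ₁ * inner ℝ (h j) Δ₁) = x4 at *
  generalize (∑ j ∈ I, inner ℝ (g j) Δ ^ 2) = x5 at *
  generalize (∑ j ∈ I, inner ℝ (g' j) Δ ^ 2) = x6 at *
  generalize (if i₀ ∈ I then (1 : ℝ) else 0) = χ at *
  linarith

/-- If `a² ≤ b² + β + 2 c x` and `x ≤ √(2 / l) a`, then `a` exceeds `b` by at most
`√β + 3 c / √l`. -/
theorem le_add_sqrt_of_sq_le {a b β c x l : ℝ} (ha : 0 ≤ a) (hb : 0 ≤ b) (hβ : 0 ≤ β)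
    (hc : 0 ≤ c) (hl : 0 < l) (hxa : l / 2 * x ^ 2 ≤ a ^ 2)
    (h : a ^ 2 ≤ b ^ 2 + β + 2 * c * x) : a ≤ b + √β + 3 * (c / √l) := by
  have hs : 0 < √l := Real.sqrt_pos.2 hl
  have hsl : √l ^ 2 = l := Real.sq_sqrt hl.le
  have hsβ : √β ^ 2 = β := Real.sq_sqrt hβ
  -- Here `√2` is rounded up to `3 / 2`; the `2` is there because in the midpoint metric only one of
  -- the two preconditioners is known to be at least `l`.
  have h1 : x ≤ 3 / 2 * (a / √l) := by
    refine abs_le_of_sq_le_sq' ?_ (by positivity) |>.2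
    have : (3 / 2 * (a / √l)) ^ 2 = 9 / 4 * (a ^ 2 / l) := by rw [mul_pow, div_pow a, hsl]; ring
    rw [this]
    have h2 : x ^ 2 ≤ 2 * (a ^ 2 / l) := by
      rw [← mul_div_assoc, le_div_iff₀ hl]; linarith
    have : 0 ≤ a ^ 2 / l := by positivity
    linarith
  set e := c / √l with he
  have he0 : 0 ≤ e := by positivity
  have h2 : 2 * c * x ≤ 3 * e * a := by
    calc 2 * c * x ≤ 2 * c * (3 / 2 * (a / √l)) := by gcongr
      _ = 3 * e * a := by rw [he]; ring
  -- If `a > b + √β + 3e`, multiplying by `a` gives `a² > (b + √β)² + 3ea ≥ b² + β + 3ea`.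
  by_contra! hlt
  have hsβ0 := Real.sqrt_nonneg β
  nlinarith [mul_nonneg hb hsβ0, mul_nonneg he0 ha]

end SGN

/-! ### Quadratic forms of preconditioners and projections in their metrics -/

namespace SGN

noncomputable section

variable {d m H : ℕ}

/-- The bilinear form `uᵀ M v` on the parameter space. -/
def matForm (M : Matrix (ParamIdx d m H) (ParamIdx d m H) ℝ) :
    Param d m H →ₗ[ℝ] Param d m H →ₗ[ℝ] ℝ :=
  LinearMap.mk₂ ℝ (fun u v => u.ofLp ⬝ᵥ (M *ᵥ v.ofLp))
    (fun u u' v => by simp [add_dotProduct]) (fun c u v => by simp [smul_dotProduct])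
    (fun u v v' => by simp [Matrix.mulVec_add, dotProduct_add])
    (fun c u v => by simp [Matrix.mulVec_smul, dotProduct_smul])

theorem matForm_apply (M : Matrix (ParamIdx d m H) (ParamIdx d m H) ℝ) (u v : Param d m H) :
    matForm M u v = u.ofLp ⬝ᵥ (M *ᵥ v.ofLp) := rfl

theorem dotProduct_eq_inner (u v : Param d m H) : u.ofLp ⬝ᵥ v.ofLp = inner ℝ u v := by
  rw [EuclideanSpace.inner_eq_star_dotProduct, star_trivial, dotProduct_comm]

theorem matForm_add (M N : Matrix (ParamIdx d m H) (ParamIdx d m H) ℝ) (u v : Param d m H) :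
    matForm (M + N) u v = matForm M u v + matForm N u v := by
  simp [matForm_apply, Matrix.add_mulVec, dotProduct_add]

theorem matForm_smul (c : ℝ) (M : Matrix (ParamIdx d m H) (ParamIdx d m H) ℝ)
    (u v : Param d m H) : matForm (c • M) u v = c * matForm M u v := by
  simp [matForm_apply, Matrix.smul_mulVec, dotProduct_smul]

theorem matForm_one (u v : Param d m H) : matForm 1 u v = inner ℝ u v := by
  rw [matForm_apply, Matrix.one_mulVec, dotProduct_eq_inner]

theorem matForm_transpose_mul {ι : Type} [Fintype ι] (J : Matrix ι (ParamIdx d m H) ℝ)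
    (u v : Param d m H) :
    matForm (Jᵀ * J) u v = ∑ j, (J *ᵥ u.ofLp) j * (J *ᵥ v.ofLp) j := by
  rw [matForm_apply, ← Matrix.mulVec_mulVec, Matrix.dotProduct_mulVec, Matrix.vecMul_transpose]
  rfl

theorem metricNorm_sq {M : Matrix (ParamIdx d m H) (ParamIdx d m H) ℝ} {v : Param d m H}
    (h : 0 ≤ matForm M v v) : metricNorm M v ^ 2 = matForm M v v :=
  Real.sq_sqrt h

theorem metricNorm_nonneg (M : Matrix (ParamIdx d m H) (ParamIdx d m H) ℝ) (v : Param d m H) :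
    0 ≤ metricNorm M v := Real.sqrt_nonneg _

theorem continuous_matForm_self (M : Matrix (ParamIdx d m H) (ParamIdx d m H) ℝ) :
    Continuous fun v => matForm M v v := by
  simp only [matForm_apply, dotProduct, Matrix.mulVec]
  fun_prop

theorem metricProj_spec {C : Set (Param d m H)} (hC : IsCompact C) (hne : C.Nonempty)
    (M : Matrix (ParamIdx d m H) (ParamIdx d m H) ℝ) (u : Param d m H) :
    metricProj C M u ∈ C ∧
      ∀ v ∈ C, metricNorm M (metricProj C M u - u) ≤ metricNorm M (v - u) := by
  have hcont : Continuous fun v => metricNorm M (v - u) :=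
    ((continuous_matForm_self M).comp (continuous_id.sub continuous_const)).sqrt
  obtain ⟨v, hv, hmin⟩ := hC.exists_isMinOn hne hcont.continuousOn
  exact Classical.epsilon_spec (p := fun v => v ∈ C ∧
    ∀ v' ∈ C, metricNorm M (v - u) ≤ metricNorm M (v' - u)) ⟨v, hv, fun v' hv' => hmin hv'⟩

/-- The variational inequality of the projection. -/
theorem metricProj_variational {C : Set (Param d m H)} (hC : IsCompact C) (hconv : Convex ℝ C)
    {M : Matrix (ParamIdx d m H) (ParamIdx d m H) ℝ} (hs : ∀ u v, matForm M u v = matForm M v u)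
    (hM : ∀ v, 0 ≤ matForm M v v) (u : Param d m H) {v : Param d m H} (hv : v ∈ C) :
    0 ≤ matForm M (metricProj C M u - u) (v - metricProj C M u) := by
  obtain ⟨hmem, hmin⟩ := metricProj_spec hC ⟨v, hv⟩ M u
  set w := metricProj C M u
  by_contra! hneg
  set b := matForm M (w - u) (v - w)
  set c := matForm M (v - w) (v - w)
  have hc : 0 ≤ c := hM _
  have key : ∀ t : ℝ, 0 ≤ t → t ≤ 1 → 0 ≤ 2 * t * b + t ^ 2 * c := fun t h0 h1 => by
    have hmem' : w + t • (v - w) ∈ C := by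
      have := hconv hmem hv (sub_nonneg.2 h1) h0 (by ring)
      convert this using 1
      rw [smul_sub, sub_smul, one_smul]; abel
    have h2 := pow_le_pow_left₀ (metricNorm_nonneg _ _) (hmin _ hmem') 2
    rw [metricNorm_sq (hM _), metricNorm_sq (hM _),
      show w + t • (v - w) - u = (w - u) + t • (v - w) by abel] at h2
    simp only [map_add, LinearMap.add_apply, map_smul, LinearMap.smul_apply, smul_eq_mul] at h2
    have h3 := hs (v - w) (w - u)
    rw [h3] at h2
    change matForm M (w - u) (w - u) ≤ matForm M (w - u) (w - u) + t * b + t * (b + t * c) at h2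
    nlinarith
  -- The value `t = 1` forces `c ≥ -2b > 0`, so the minimizer `-b / c` of the quadratic lies in the
  -- unit interval, where its value is negative.
  have h1 := key 1 (by norm_num) le_rfl
  have hcpos : 0 < c := by linarith
  have ht1 : -b / c ≤ 1 := by rw [div_le_one hcpos]; linarith
  have h2 := key (-b / c) (div_nonneg (by linarith) hc) ht1
  have h3 : 2 * (-b / c) * b + (-b / c) ^ 2 * c = -(b ^ 2 / c) := by field_simp; ring
  rw [h3] at h2
  have : 0 < b ^ 2 / c := div_pos (sq_pos_of_neg hneg) hcpos
  linarith

/-- `y ↦ yᵀ M (M⁻¹ v)` is the inner product with `v`. -/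
theorem matForm_inv {M : Matrix (ParamIdx d m H) (ParamIdx d m H) ℝ} {lam : ℝ} (hlam : 0 < lam)
    (hM : ∀ v, lam * ‖v‖ ^ 2 ≤ matForm M v v) (y v : Param d m H) :
    matForm M y (WithLp.toLp 2 (M⁻¹ *ᵥ v.ofLp)) = inner ℝ y v := by
  have hinj : Function.Injective M.mulVec := by
    rw [← Matrix.coe_mulVecLin, injective_iff_map_eq_zero]
    intro z hz
    have h1 := hM (WithLp.toLp 2 z)
    rw [matForm_apply] at h1
    change lam * ‖WithLp.toLp 2 z‖ ^ 2 ≤ z ⬝ᵥ (M.mulVecLin z) at h1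
    rw [hz, dotProduct_zero] at h1
    have h2 : ‖(WithLp.toLp 2 z : Param d m H)‖ ^ 2 = 0 :=
      le_antisymm (by nlinarith [sq_nonneg ‖(WithLp.toLp 2 z : Param d m H)‖]) (sq_nonneg _)
    have h3 : (WithLp.toLp 2 z : Param d m H) = 0 := by simpa using h2
    simpa using h3
  have hdet : IsUnit M.det :=
    (Matrix.isUnit_iff_isUnit_det M).1 (Matrix.mulVec_injective_iff_isUnit.1 hinj)
  rw [matForm_apply, Matrix.mulVec_mulVec, Matrix.mul_nonsing_inv _ hdet, Matrix.one_mulVec,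
    dotProduct_eq_inner]

/-! ### Smoothness of the network -/

theorem contDiff_features {σ : ℝ → ℝ} (hσ : ContDiff ℝ 2 σ) :
    ∀ (h : ℕ) (hh : h ≤ H) (i : Fin (layerWidth d m h)),
      ContDiff ℝ 2 fun p : EuclideanSpace ℝ (Fin d) × Param d m H => features σ p.1 p.2 h hh i
  | 0, _, i => by
    simp only [features]
    exact (EuclideanSpace.proj (𝕜 := ℝ) i).contDiff.comp contDiff_fst
  | h + 1, hh, i => by
    simp only [features]
    refine contDiff_const.mul (hσ.comp (ContDiff.sum fun j _ => ContDiff.mul ?_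
      (contDiff_features hσ h (Nat.le_of_succ_le hh) j)))
    exact (EuclideanSpace.proj (𝕜 := ℝ) (Sum.inl (⟨⟨h, hh⟩, i, j⟩ :
      Σ h : Fin H, Fin m × Fin (layerWidth d m h)) : ParamIdx d m H)).contDiff.comp contDiff_snd

theorem contDiff_predictor {σ : ℝ → ℝ} (hσ : ContDiff ℝ 2 σ) :
    ContDiff ℝ 2 fun p : EuclideanSpace ℝ (Fin d) × Param d m H => predictor σ p.1 p.2 := by
  simp only [predictor]
  refine ContDiff.sum fun i _ => ContDiff.mul ?_ (contDiff_features hσ H le_rfl i)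
  exact (EuclideanSpace.proj (𝕜 := ℝ) (Sum.inr i : ParamIdx d m H)).contDiff.comp contDiff_snd

theorem differentiable_predictor {σ : ℝ → ℝ} (hσ : ContDiff ℝ 2 σ)
    (x : EuclideanSpace ℝ (Fin d)) :
    Differentiable ℝ (predictor σ x : Param d m H → ℝ) :=
  ((contDiff_predictor hσ).comp (contDiff_const.prodMk contDiff_id)).differentiable (by norm_num)

/-- Compactness of the unit ball times `C` makes the set under `sSup` bounded; without boundedness
the real supremum would take its default value `0` and bound nothing. -/
theorem abs_predictor_le {σ : ℝ → ℝ} (hσ : ContDiff ℝ 2 σ) {C : Set (Param d m H)}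
    (hC : IsCompact C) {x : EuclideanSpace ℝ (Fin d)} (hx : ‖x‖ ≤ 1) {w : Param d m H}
    (hw : w ∈ C) : |predictor σ x w| ≤ predictionRadius σ C := by
  refine le_csSup ?_ ⟨x, hx, w, hw, rfl⟩
  have hK : IsCompact (Metric.closedBall (0 : EuclideanSpace ℝ (Fin d)) 1 ×ˢ C) :=
    (isCompact_closedBall 0 1).prod hC
  obtain ⟨b, hb⟩ := hK.exists_bound_of_continuousOn (contDiff_predictor hσ).continuous.continuousOn
  refine ⟨b, ?_⟩
  rintro a ⟨x, hx, w, hw, rfl⟩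
  exact hb (x, w) ⟨by simpa using hx, hw⟩

theorem predictor_mem_range {σ : ℝ → ℝ} (hσ : ContDiff ℝ 2 σ) {C : Set (Param d m H)}
    (hC : IsCompact C) {x : EuclideanSpace ℝ (Fin d)} (hx : ‖x‖ ≤ 1) {w : Param d m H}
    (hw : w ∈ C) : predictor σ x w ∈ predictionRange σ C :=
  abs_le.1 (abs_predictor_le hσ hC hx hw)

/-- First-order expansion of the predictor along `C`, with the gradient at any point of the
segment. -/
theorem predictor_expansion {σ : ℝ → ℝ} (hσ : ContDiff ℝ 2 σ) {C : Set (Param d m H)}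
    (hconv : Convex ℝ C) {Lg : ℝ} (hLg : 0 ≤ Lg) {x : EuclideanSpace ℝ (Fin d)}
    (hlip : ∀ w ∈ C, ∀ w' ∈ C,
      ‖gradient (predictor σ x) w - gradient (predictor σ x) w'‖ ≤ Lg * ‖w - w'‖)
    {w w' : Param d m H} (hw : w ∈ C) (hw' : w' ∈ C) :
    |inner ℝ (gradient (predictor σ x) w) (w - w') - (predictor σ x w - predictor σ x w')|
      ≤ Lg * ‖w - w'‖ ^ 2 := by
  obtain ⟨ξ, hξ, h⟩ := domain_mvt (fun y _ =>
    ((differentiable_predictor hσ x) y).hasFDerivAt.hasFDerivWithinAt) hconv hw' hw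
  have hξC : ξ ∈ C := hconv.segment_subset hw' hw hξ
  rw [h, ← inner_gradient_left, ← inner_sub_left]
  refine (abs_real_inner_le_norm _ _).trans ?_
  have h1 : ‖w - ξ‖ ≤ ‖w - w'‖ := by
    rw [← dist_eq_norm, ← dist_eq_norm, dist_comm w w', dist_comm w ξ,
      ← dist_add_dist_of_mem_segment hξ]
    linarith [dist_nonneg (x := w') (y := ξ)]
  calc _ ≤ Lg * ‖w - ξ‖ * ‖w - w'‖ :=
        mul_le_mul_of_nonneg_right (hlip w hw ξ hξC) (norm_nonneg _)
    _ ≤ Lg * ‖w - w'‖ * ‖w - w'‖ := by gcongr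
    _ = _ := by ring

theorem abs_predictor_sub_le {σ : ℝ → ℝ} (hσ : ContDiff ℝ 2 σ) {C : Set (Param d m H)}
    (hconv : Convex ℝ C) {Lφ : ℝ} {x : EuclideanSpace ℝ (Fin d)}
    (hlip : ∀ w ∈ C, ‖gradient (predictor σ x) w‖ ≤ Lφ)
    {w w' : Param d m H} (hw : w ∈ C) (hw' : w' ∈ C) :
    |predictor σ x w - predictor σ x w'| ≤ Lφ * ‖w - w'‖ := by
  obtain ⟨ξ, hξ, h⟩ := domain_mvt (fun y _ =>
    ((differentiable_predictor hσ x) y).hasFDerivAt.hasFDerivWithinAt) hconv hw' hw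
  rw [h, ← inner_gradient_left]
  exact (abs_real_inner_le_norm _ _).trans
    (mul_le_mul_of_nonneg_right (hlip ξ (hconv.segment_subset hw' hw hξ)) (norm_nonneg _))

/-! ### The loss -/

/-- Subtracting `ν y² / 2` leaves a convex function, whose derivative is monotone. -/
theorem IsRegularLoss.le_deriv_deriv {ℓ : ℝ → Sample d → ℝ} {Z : Set (Sample d)} {ν : ℝ}
    (h : IsRegularLoss ℓ Z ν) {z : Sample d} (hz : z ∈ Z) (y : ℝ) :
    ν ≤ deriv (deriv fun u => ℓ u z) y := by
  have hc := strongConvexOn_iff_convex.1 (h.strongConvex z hz)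
  simp only [Real.norm_eq_abs, sq_abs] at hc
  have hd : ∀ x, HasDerivAt (fun u => ℓ u z - ν / 2 * u ^ 2)
      (deriv (fun u => ℓ u z) x - ν * x) x := fun x => by
    have h1 := (h.differentiable z hz x).hasDerivAt.sub
      (((hasDerivAt_id x).pow 2).const_mul (ν / 2))
    refine h1.congr_deriv ?_
    simp only [id]; ring
  have hmono : MonotoneOn (deriv fun u => ℓ u z - ν / 2 * u ^ 2) Set.univ :=
    hc.monotoneOn_deriv fun x _ => (hd x).differentiableAt
  have hmono' : Monotone fun x => deriv (fun u => ℓ u z) x - ν * x := fun a b hab => by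
    have := hmono (Set.mem_univ a) (Set.mem_univ b) hab
    rwa [(hd a).deriv, (hd b).deriv] at this
  have h2 := ((h.differentiable_deriv z hz y).hasDerivAt.sub ((hasDerivAt_id y).const_mul ν))
  have h3 : 0 ≤ deriv (fun x => deriv (fun u => ℓ u z) x - ν * x) y := hmono'.deriv_nonneg
  have h4 : deriv (fun x => deriv (fun u => ℓ u z) x - ν * x) y
      = deriv (deriv fun u => ℓ u z) y - ν * 1 := h2.deriv
  linarith

/-- Strong monotonicity and cocoercivity of `ℓ'` on the range of predictions. -/
theorem IsRegularLoss.deriv_sub_mul {ℓ : ℝ → Sample d → ℝ} {Z : Set (Sample d)} {ν L : ℝ}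
    (h : IsRegularLoss ℓ Z ν) (hν : 0 < ν) {z : Sample d} (hz : z ∈ Z) {R : Set ℝ}
    (hR : R.OrdConnected) (hL : ∀ y ∈ R, deriv (deriv fun u => ℓ u z) y ≤ L)
    {a b : ℝ} (ha : a ∈ R) (hb : b ∈ R) :
    ν * (a - b) ^ 2 ≤ (deriv (fun u => ℓ u z) a - deriv (fun u => ℓ u z) b) * (a - b) ∧
      (deriv (fun u => ℓ u z) a - deriv (fun u => ℓ u z) b) ^ 2
        ≤ L * ((deriv (fun u => ℓ u z) a - deriv (fun u => ℓ u z) b) * (a - b)) := by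
  -- The mean value theorem gives slope difference `κ (a - b)` with `ν ≤ κ ≤ L`, hence also `κ² ≤ L
  -- κ`; continuity of the second derivative is not needed.
  obtain ⟨ξ, hξ, hmvt⟩ := domain_mvt (s := R) (f := deriv fun u => ℓ u z)
    (fun y _ => (h.differentiable_deriv z hz y).hasFDerivAt.hasFDerivWithinAt) hR.convex hb ha
  have hξR : ξ ∈ R := hR.convex.segment_subset hb ha hξ
  have hk : deriv (fun u => ℓ u z) a - deriv (fun u => ℓ u z) b
      = deriv (deriv fun u => ℓ u z) ξ * (a - b) := by
    rw [hmvt, ← fderiv_apply_one_eq_deriv, mul_comm, ← smul_eq_mul, ← map_smul, smul_eq_mul,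
      mul_one]
  have h1 := h.le_deriv_deriv hz ξ
  have h2 := hL ξ hξR
  rw [hk]
  generalize deriv (deriv fun u => ℓ u z) ξ = κ at h1 h2
  have h3 := sq_nonneg (a - b)
  refine ⟨by nlinarith, ?_⟩
  have h4 : 0 ≤ κ * (a - b) ^ 2 := mul_nonneg (hν.le.trans h1) h3
  nlinarith

/-- The loss is Lipschitz on the range of predictions. -/
theorem IsRegularLoss.abs_sub_le {ℓ : ℝ → Sample d → ℝ} {Z : Set (Sample d)} {ν Lℓ : ℝ}
    (h : IsRegularLoss ℓ Z ν) {z : Sample d} (hz : z ∈ Z) {R : Set ℝ} (hR : R.OrdConnected)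
    (hL : ∀ y ∈ R, |deriv (fun u => ℓ u z) y| ≤ Lℓ) {a b : ℝ} (ha : a ∈ R) (hb : b ∈ R) :
    |ℓ a z - ℓ b z| ≤ Lℓ * |a - b| :=
  hR.convex.norm_image_sub_le_of_norm_deriv_le (fun y _ => h.differentiable z hz y) hL hb ha

end

end SGN

/-! ### Samplewise estimates -/

namespace SGN

noncomputable section

variable {d m H : ℕ}

/-- The gradient of the predictor at the `j`-th sample. -/
def sampleGrad (σ : ℝ → ℝ) {n : ℕ} (s : Fin n → Sample d) (w : Param d m H) (j : Fin n) :
    Param d m H := gradient (predictor σ (s j).1) w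

/-- The derivative of the loss at the `j`-th prediction. -/
def sampleSlope (σ : ℝ → ℝ) (ℓ : ℝ → Sample d → ℝ) {n : ℕ} (s : Fin n → Sample d)
    (w : Param d m H) (j : Fin n) : ℝ := deriv (fun y => ℓ y (s j)) (predictor σ (s j).1 w)

theorem jacobian_mulVec (σ : ℝ → ℝ) {n : ℕ} (s : Fin n → Sample d) (I : Finset (Fin n))
    (w u : Param d m H) (j : I) :
    (jacobian σ (batch s I) w *ᵥ u.ofLp) j = inner ℝ (sampleGrad σ s w j) u := by
  rw [← dotProduct_eq_inner]; rfl

theorem matForm_jacobian (σ : ℝ → ℝ) {n : ℕ} (s : Fin n → Sample d) (I : Finset (Fin n))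
    (w u v : Param d m H) :
    matForm ((jacobian σ (batch s I) w)ᵀ * jacobian σ (batch s I) w) u v
      = ∑ j ∈ I, inner ℝ (sampleGrad σ s w j) u * inner ℝ (sampleGrad σ s w j) v := by
  rw [matForm_transpose_mul]
  simp only [jacobian_mulVec]
  exact Finset.sum_coe_sort I
    fun j => inner ℝ (sampleGrad σ s w j) u * inner ℝ (sampleGrad σ s w j) v

theorem batchGradient_eq (σ : ℝ → ℝ) (ℓ : ℝ → Sample d → ℝ) {n : ℕ} (s : Fin n → Sample d)
    (I : Finset (Fin n)) (w : Param d m H) :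
    batchGradient σ ℓ s I w = ∑ j ∈ I, sampleSlope σ ℓ s w j • sampleGrad σ s w j := by
  rw [← Finset.sum_coe_sort]
  ext i
  simp only [batchGradient, Matrix.mulVec, dotProduct, Matrix.transpose_apply, WithLp.ofLp_sum,
    Finset.sum_apply, PiLp.smul_apply, smul_eq_mul]
  exact Finset.sum_congr rfl fun j _ => mul_comm _ _

/-- The standing assumptions on network, parameter set, samples and loss. -/
structure IsRegularModel (σ : ℝ → ℝ) (C : Set (Param d m H)) (Z : Set (Sample d))
    (ℓ : ℝ → Sample d → ℝ) (r Lφ Lℓ L Lg ν : ℝ) : Prop where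
  contDiff : ContDiff ℝ 2 σ
  isCompact : IsCompact C
  convex : Convex ℝ C
  diam_le : Metric.diam C ≤ r
  norm_le : ∀ z ∈ Z, ‖z.1‖ ≤ 1
  loss : IsRegularLoss ℓ Z ν
  slope_le : ∀ z ∈ Z, ∀ y ∈ predictionRange σ C, |deriv (fun u => ℓ u z) y| ≤ Lℓ
  curvature_le : ∀ z ∈ Z, ∀ y ∈ predictionRange σ C, deriv (deriv fun u => ℓ u z) y ≤ L
  grad_le : ∀ x : EuclideanSpace ℝ (Fin d), ‖x‖ ≤ 1 → ∀ w ∈ C,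
    ‖gradient (predictor σ x) w‖ ≤ Lφ
  grad_lip : ∀ x : EuclideanSpace ℝ (Fin d), ‖x‖ ≤ 1 → ∀ w ∈ C, ∀ w' ∈ C,
    ‖gradient (predictor σ x) w - gradient (predictor σ x) w'‖ ≤ Lg * ‖w - w'‖
  r_nonneg : 0 ≤ r
  Lφ_pos : 0 < Lφ
  Lℓ_nonneg : 0 ≤ Lℓ
  L_pos : 0 < L
  Lg_nonneg : 0 ≤ Lg
  ν_pos : 0 < ν

namespace IsRegularModel

variable {σ : ℝ → ℝ} {C : Set (Param d m H)} {Z : Set (Sample d)}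
  {ℓ : ℝ → Sample d → ℝ} {r Lφ Lℓ L Lg ν : ℝ} {n : ℕ} {s s' : Fin n → Sample d}

theorem norm_sub_le_of_mem (hS : IsRegularModel σ C Z ℓ r Lφ Lℓ L Lg ν) {w w' : Param d m H}
    (hw : w ∈ C) (hw' : w' ∈ C) : ‖w - w'‖ ≤ r := by
  rw [← dist_eq_norm]
  exact (Metric.dist_le_diam_of_mem hS.isCompact.isBounded hw hw').trans hS.diam_le

theorem norm_sampleGrad_le (hS : IsRegularModel σ C Z ℓ r Lφ Lℓ L Lg ν) (hs : ∀ j, s j ∈ Z)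
    {w : Param d m H} (hw : w ∈ C) (j : Fin n) : ‖sampleGrad σ s w j‖ ≤ Lφ :=
  hS.grad_le _ (hS.norm_le _ (hs j)) w hw

theorem abs_sampleSlope_le (hS : IsRegularModel σ C Z ℓ r Lφ Lℓ L Lg ν) (hs : ∀ j, s j ∈ Z)
    {w : Param d m H} (hw : w ∈ C) (j : Fin n) : |sampleSlope σ ℓ s w j| ≤ Lℓ :=
  hS.slope_le _ (hs j) _
    (predictor_mem_range hS.contDiff hS.isCompact (hS.norm_le _ (hs j)) hw)

/-- The Gauss-Newton gradients of one minibatch of one training set at two parameters. -/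
theorem gradient_gap (hS : IsRegularModel σ C Z ℓ r Lφ Lℓ L Lg ν) (hs : ∀ j, s j ∈ Z)
    {w w' : Param d m H} (hw : w ∈ C) (hw' : w' ∈ C) {I : Finset (Fin n)} {B : ℕ}
    (hB : I.card = B) (hB1 : 1 ≤ B) {η α lam ε Λ : ℝ} (hη : 0 < η) (hα : 0 < α)
    (hε : ε = B * Lℓ * Lg) (hΛ : Λ = B * L * Lφ ^ 2 + ε) (hηΛ : η / lam ≤ 1 / Λ)
    (hαη : 2 * α ≤ η * ν) :
    α / 2 * ∑ j ∈ I, (inner ℝ (sampleGrad σ s w j) (w - w') ^ 2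
          + inner ℝ (sampleGrad σ s w' j) (w - w') ^ 2)
        - 2 * η * inner ℝ (∑ j ∈ I, (sampleSlope σ ℓ s w j • sampleGrad σ s w j
          - sampleSlope σ ℓ s w' j • sampleGrad σ s w' j)) (w - w')
        + η ^ 2 / lam * ‖∑ j ∈ I, (sampleSlope σ ℓ s w j • sampleGrad σ s w j
          - sampleSlope σ ℓ s w' j • sampleGrad σ s w' j)‖ ^ 2
      ≤ 5 * (η * ε) * r ^ 2 + 2 * α * B * Lg ^ 2 * r ^ 4 := by
  have hZ := fun j => hS.norm_le _ (hs j)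
  have hmem : ∀ j, ∀ u ∈ C, predictor σ (s j).1 u ∈ predictionRange σ C := fun j u hu =>
    predictor_mem_range hS.contDiff hS.isCompact (hZ j) hu
  have hloss := fun j => hS.loss.deriv_sub_mul hS.ν_pos (hs j)
    (R := predictionRange σ C) Set.ordConnected_Icc (hS.curvature_le _ (hs j)) (hmem j w hw)
    (hmem j w' hw')
  have hr := hS.norm_sub_le_of_mem hw hw'
  have hε0 : 0 ≤ ε := by
    have := hS.Lℓ_nonneg
    have := hS.Lg_nonneg
    rw [hε]; positivity
  refine (gradient_gap_coercive I B hB (sampleGrad σ s w) (sampleGrad σ s w') (sampleSlope σ ℓ s w)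
    (sampleSlope σ ℓ s w') (fun j => predictor σ (s j).1 w - predictor σ (s j).1 w') (w - w') _
    hS.Lφ_pos hS.Lℓ_nonneg hS.L_pos hS.Lg_nonneg hη hα hB1 hε hΛ hηΛ hαη
    (fun j _ => hS.norm_sampleGrad_le hs hw j)
    (fun j _ => hS.grad_lip _ (hZ j) w hw w' hw')
    (fun j _ => predictor_expansion hS.contDiff hS.convex hS.Lg_nonneg (hS.grad_lip _ (hZ j)) hw hw')
    (fun j _ => ?_) (fun j _ => hS.abs_sampleSlope_le hs hw j)
    (fun j _ => hS.abs_sampleSlope_le hs hw' j)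
    (fun j _ => (hloss j).1) (fun j _ => (hloss j).2) rfl).trans ?_
  -- The expansion based at `w'` is the one at `w` with the roles exchanged; both differences change
  -- sign.
  · have := predictor_expansion hS.contDiff hS.convex hS.Lg_nonneg (hS.grad_lip _ (hZ j)) hw' hw
    rw [norm_sub_rev, ← neg_sub w w', inner_neg_right, ← abs_neg] at this
    rw [sampleGrad]
    convert this using 2
    ring
  · gcongr

/-- The contribution of the sample in which `s` and `s'` differ to the minibatch gradient. -/
theorem norm_batchGradient_sub_le (hS : IsRegularModel σ C Z ℓ r Lφ Lℓ L Lg ν)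
    (hs : ∀ j, s j ∈ Z) (hs' : ∀ j, s' j ∈ Z) {i₀ : Fin n} (hi₀ : ∀ j, j ≠ i₀ → s j = s' j)
    {w : Param d m H} (hw : w ∈ C) (I : Finset (Fin n)) :
    ‖∑ j ∈ I, (sampleSlope σ ℓ s w j • sampleGrad σ s w j
        - sampleSlope σ ℓ s' w j • sampleGrad σ s' w j)‖
      ≤ 2 * Lφ * Lℓ * (if i₀ ∈ I then 1 else 0) := by
  have hc : 2 * Lφ * Lℓ * (if i₀ ∈ I then (1 : ℝ) else 0)
      = ∑ j ∈ I, if j = i₀ then 2 * Lφ * Lℓ else 0 := by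
    rw [Finset.sum_ite_eq']; split_ifs <;> simp
  rw [hc]
  refine (norm_sum_le _ _).trans (Finset.sum_le_sum fun j _ => ?_)
  split_ifs with h
  · have key : ∀ q : Fin n → Sample d, (∀ j, q j ∈ Z) →
        ‖sampleSlope σ ℓ q w j • sampleGrad σ q w j‖ ≤ Lℓ * Lφ := fun q hq => by
      rw [norm_smul]
      exact mul_le_mul (hS.abs_sampleSlope_le hq hw j) (hS.norm_sampleGrad_le hq hw j)
        (norm_nonneg _) hS.Lℓ_nonneg
    refine (norm_sub_le _ _).trans ?_
    linarith [key s hs, key s' hs']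
  · simp [sampleSlope, sampleGrad, hi₀ j h]

/-- The change of the Gram form of one minibatch. -/
theorem abs_gram_sub_le (hS : IsRegularModel σ C Z ℓ r Lφ Lℓ L Lg ν)
    (hs : ∀ j, s j ∈ Z) (hs' : ∀ j, s' j ∈ Z) {i₀ : Fin n} (hi₀ : ∀ j, j ≠ i₀ → s j = s' j)
    {w w' : Param d m H} (hw : w ∈ C) (hw' : w' ∈ C) {I : Finset (Fin n)} {B : ℕ}
    (hB : I.card = B) (u v : Param d m H) :
    |∑ j ∈ I, inner ℝ (sampleGrad σ s w j) u * inner ℝ (sampleGrad σ s w j) v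
        - ∑ j ∈ I, inner ℝ (sampleGrad σ s' w' j) u * inner ℝ (sampleGrad σ s' w' j) v|
      ≤ (B * (2 * Lφ * Lg * r) + 2 * Lφ ^ 2 * (if i₀ ∈ I then 1 else 0)) * ‖u‖ * ‖v‖ := by
  have hφ := hS.Lφ_pos
  have hg := hS.Lg_nonneg
  have hr := hS.r_nonneg
  have hc : (B * (2 * Lφ * Lg * r) + 2 * Lφ ^ 2 * (if i₀ ∈ I then (1 : ℝ) else 0)) * ‖u‖ * ‖v‖
      = ∑ j ∈ I, (2 * Lφ * Lg * r * ‖u‖ * ‖v‖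
        + if j = i₀ then 2 * Lφ ^ 2 * ‖u‖ * ‖v‖ else 0) := by
    rw [Finset.sum_add_distrib, Finset.sum_ite_eq', Finset.sum_const, hB, nsmul_eq_mul]
    split_ifs <;> ring
  rw [hc, ← Finset.sum_sub_distrib]
  refine (Finset.abs_sum_le_sum_abs _ _).trans (Finset.sum_le_sum fun j _ => ?_)
  have key : ∀ x y z : Param d m H, ∀ A : ℝ, ‖x‖ ≤ A → ‖y‖ ≤ Lφ →
      |inner ℝ x z| ≤ A * ‖z‖ ∧ |inner ℝ y z| ≤ Lφ * ‖z‖ := fun x y z A hx hy =>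
    ⟨(abs_real_inner_le_norm _ _).trans (mul_le_mul_of_nonneg_right hx (norm_nonneg _)),
      (abs_real_inner_le_norm _ _).trans (mul_le_mul_of_nonneg_right hy (norm_nonneg _))⟩
  have hx := hS.norm_sampleGrad_le hs hw j
  have hy := hS.norm_sampleGrad_le hs' hw' j
  set x := sampleGrad σ s w j with hxdef
  set y := sampleGrad σ s' w' j with hydef
  split_ifs with h
  · have e1 : |inner ℝ x u * inner ℝ x v| ≤ (Lφ * ‖u‖) * (Lφ * ‖v‖) := by
      rw [abs_mul]
      exact mul_le_mul (key x x u _ hx hx).1 (key x x v _ hx hx).1 (abs_nonneg _) (by positivity)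
    have e2 : |inner ℝ y u * inner ℝ y v| ≤ (Lφ * ‖u‖) * (Lφ * ‖v‖) := by
      rw [abs_mul]
      exact mul_le_mul (key y y u _ hy hy).1 (key y y v _ hy hy).1 (abs_nonneg _) (by positivity)
    have e3 : 0 ≤ 2 * Lφ * Lg * r * ‖u‖ * ‖v‖ := by positivity
    refine (abs_sub _ _).trans ?_
    linarith
  · have hxy : ‖x - y‖ ≤ Lg * r := by
      have : y = sampleGrad σ s w' j := by rw [hydef, sampleGrad, sampleGrad, hi₀ j h]
      rw [this]
      exact (hS.grad_lip _ (hS.norm_le _ (hs j)) w hw w' hw').trans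
        (mul_le_mul_of_nonneg_left (hS.norm_sub_le_of_mem hw hw') hg)
    have e0 : inner ℝ x u * inner ℝ x v - inner ℝ y u * inner ℝ y v
        = inner ℝ (x - y) u * inner ℝ x v + inner ℝ y u * inner ℝ (x - y) v := by
      rw [inner_sub_left, inner_sub_left]; ring
    have e1 : |inner ℝ (x - y) u * inner ℝ x v| ≤ (Lg * r * ‖u‖) * (Lφ * ‖v‖) := by
      rw [abs_mul]
      exact mul_le_mul (key _ x u _ hxy hx).1 (key x x v _ hx hx).2 (abs_nonneg _) (by positivity)
    have e2 : |inner ℝ y u * inner ℝ (x - y) v| ≤ (Lφ * ‖u‖) * (Lg * r * ‖v‖) := by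
      rw [abs_mul]
      exact mul_le_mul (key y y u _ hy hy).1 (key _ y v _ hxy hy).1 (abs_nonneg _) (by positivity)
    rw [e0]
    refine (abs_add_le _ _).trans ?_
    linarith

end IsRegularModel

/-! ### The run -/

section Run

variable {σ : ℝ → ℝ} {ℓ : ℝ → Sample d → ℝ} {C : Set (Param d m H)} {η α lam : ℝ}
  {w₀ : Param d m H} {n : ℕ} {s s' : Fin n → Sample d} {I : ℕ → Finset (Fin n)}

theorem matForm_state_zero (u v : Param d m H) :
    matForm (state σ ℓ C η α lam w₀ s I 0).2 u v = lam * inner ℝ u v := by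
  simp only [state, matForm_smul, matForm_one]

theorem matForm_state_succ (k : ℕ) (u v : Param d m H) :
    matForm (state σ ℓ C η α lam w₀ s I (k + 1)).2 u v
      = matForm (state σ ℓ C η α lam w₀ s I k).2 u v
        + α * ∑ j ∈ I k, inner ℝ (sampleGrad σ s (iterate σ ℓ C η α lam w₀ s I k) j) u
            * inner ℝ (sampleGrad σ s (iterate σ ℓ C η α lam w₀ s I k) j) v := by
  rw [← matForm_jacobian, ← matForm_smul, ← matForm_add]; rfl

theorem matForm_state_symm (k : ℕ) (u v : Param d m H) :
    matForm (state σ ℓ C η α lam w₀ s I k).2 u v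
      = matForm (state σ ℓ C η α lam w₀ s I k).2 v u := by
  induction k with
  | zero => rw [matForm_state_zero, matForm_state_zero, real_inner_comm]
  | succ k ih =>
    rw [matForm_state_succ, matForm_state_succ, ih]
    simp only [mul_comm]

theorem le_matForm_state (hα : 0 < α) (k : ℕ) (v : Param d m H) :
    lam * ‖v‖ ^ 2 ≤ matForm (state σ ℓ C η α lam w₀ s I k).2 v v := by
  induction k with
  | zero => rw [matForm_state_zero, real_inner_self_eq_norm_sq]
  | succ k ih =>
    rw [matForm_state_succ]
    have : 0 ≤ α * ∑ j ∈ I k, inner ℝ (sampleGrad σ s (iterate σ ℓ C η α lam w₀ s I k) j) v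
            * inner ℝ (sampleGrad σ s (iterate σ ℓ C η α lam w₀ s I k) j) v :=
      mul_nonneg hα.le (Finset.sum_nonneg fun j _ => mul_self_nonneg _)
    linarith

theorem iterate_mem (hC : IsCompact C) (hw₀ : w₀ ∈ C) (k : ℕ) :
    iterate σ ℓ C η α lam w₀ s I k ∈ C := by
  cases k with
  | zero => exact hw₀
  | succ k => rw [iterate_succ]; exact (metricProj_spec hC ⟨w₀, hw₀⟩ _ _).1

/-- The gradient step `η H_k⁻¹ Ψ_k` paired in the form `H_k` becomes the Euclidean pairing with
`Ψ_k`, so the gradients of runs with different preconditioners can be subtracted. -/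
theorem iterate_variational (hC : IsCompact C) (hconv : Convex ℝ C) (hα : 0 < α) (hlam : 0 < lam)
    (k : ℕ) {v : Param d m H} (hv : v ∈ C) :
    0 ≤ matForm (state σ ℓ C η α lam w₀ s I (k + 1)).2
          (iterate σ ℓ C η α lam w₀ s I (k + 1) - iterate σ ℓ C η α lam w₀ s I k)
          (v - iterate σ ℓ C η α lam w₀ s I (k + 1))
        + η * inner ℝ (batchGradient σ ℓ s (I k) (iterate σ ℓ C η α lam w₀ s I k))
          (v - iterate σ ℓ C η α lam w₀ s I (k + 1)) := by
  have hlow := le_matForm_state (σ := σ) (ℓ := ℓ) (C := C) (η := η) (lam := lam) (w₀ := w₀)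
    (s := s) (I := I) hα (k + 1)
  have hsym := matForm_state_symm (σ := σ) (ℓ := ℓ) (C := C) (η := η) (α := α) (lam := lam)
    (w₀ := w₀) (s := s) (I := I) (k + 1)
  have h := metricProj_variational hC hconv hsym
    (fun v => (by positivity : (0 : ℝ) ≤ lam * ‖v‖ ^ 2).trans (hlow v))
    (iterate σ ℓ C η α lam w₀ s I k - η • WithLp.toLp 2
          ((precond σ ℓ C η α lam w₀ s I k)⁻¹ *ᵥ
            (batchGradient σ ℓ s (I k) (iterate σ ℓ C η α lam w₀ s I k)).ofLp)) hv
  change 0 ≤ matForm (precond σ ℓ C η α lam w₀ s I k) _ _ at h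
  rw [show metricProj C (state σ ℓ C η α lam w₀ s I (k + 1)).2 _ =
    iterate σ ℓ C η α lam w₀ s I (k + 1) from (iterate_succ ..).symm] at h
  rw [← sub_add, map_add, LinearMap.add_apply, map_smul, LinearMap.smul_apply, smul_eq_mul] at h
  change 0 ≤ _ + η * matForm (state σ ℓ C η α lam w₀ s I (k + 1)).2 _ _ at h
  rw [hsym (WithLp.toLp 2 _) _] at h
  have h2 := matForm_inv hlam hlow (v - iterate σ ℓ C η α lam w₀ s I (k + 1))
    (batchGradient σ ℓ s (I k) (iterate σ ℓ C η α lam w₀ s I k))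
  rw [real_inner_comm, ← h2]
  exact h

end Run

end

end SGN

/-! ### The pathwise stability recursion -/

namespace SGN

noncomputable section

variable {d m H : ℕ}

/-- The coefficient of the linear error terms of one step, in terms of the indicators `χ t` that
the `t`-th minibatch contains the sample in which the training sets differ. -/
def stepError (r Lφ Lℓ Lg η α : ℝ) (B : ℕ) (χ : ℕ → ℝ) (k : ℕ) : ℝ :=
  α / 2 * Lφ ^ 2 * r * χ k + η * (2 * Lφ * Lℓ * χ k)
    + α * (∑ t ∈ Finset.range (k + 1), (B * (2 * Lφ * Lg * r) + 2 * Lφ ^ 2 * χ t)) * r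

variable {σ : ℝ → ℝ} {C : Set (Param d m H)} {Z : Set (Sample d)}
  {ℓ : ℝ → Sample d → ℝ} {r Lφ Lℓ L Lg ν : ℝ} {n : ℕ} {s s' : Fin n → Sample d}
  {η α lam : ℝ} {w₀ : Param d m H} {I : ℕ → Finset (Fin n)}

/-- Both preconditioners start from `λ 1`, so their difference is the accumulated change of the Gram
forms. The iterates stay in `C`, and each step therefore costs at most a fixed amount whatever the
distance of the runs. -/
theorem abs_matForm_state_sub_le (hS : IsRegularModel σ C Z ℓ r Lφ Lℓ L Lg ν)
    (hs : ∀ j, s j ∈ Z) (hs' : ∀ j, s' j ∈ Z) {i₀ : Fin n} (hi₀ : ∀ j, j ≠ i₀ → s j = s' j)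
    (hw₀ : w₀ ∈ C) (hα : 0 < α) {B : ℕ} (hB : ∀ t, (I t).card = B) (k : ℕ) (u v : Param d m H) :
    |matForm (state σ ℓ C η α lam w₀ s I k).2 u v - matForm (state σ ℓ C η α lam w₀ s' I k).2 u v|
      ≤ α * (∑ t ∈ Finset.range k,
          (B * (2 * Lφ * Lg * r) + 2 * Lφ ^ 2 * (if i₀ ∈ I t then 1 else 0))) * ‖u‖ * ‖v‖ := by
  induction k with
  | zero => simp [matForm_state_zero]
  | succ k ih =>
    rw [matForm_state_succ, matForm_state_succ, Finset.sum_range_succ]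
    have h := hS.abs_gram_sub_le hs hs' hi₀
      (iterate_mem (σ := σ) (ℓ := ℓ) (η := η) (α := α) (lam := lam) (s := s) (I := I)
        hS.isCompact hw₀ k)
      (iterate_mem (σ := σ) (ℓ := ℓ) (η := η) (α := α) (lam := lam) (s := s') (I := I)
        hS.isCompact hw₀ k) (hB k) u v
    have h' := mul_le_mul_of_nonneg_left h hα.le
    rw [← abs_of_pos hα, ← abs_mul, abs_of_pos hα, mul_sub] at h'
    rw [add_sub_add_comm]
    refine (abs_add_le _ _).trans ((add_le_add ih h').trans (le_of_eq ?_))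
    ring

/-- The distance of the iterates in the midpoint metric of the previous preconditioners. -/
def stateDist (σ : ℝ → ℝ) (ℓ : ℝ → Sample d → ℝ) (C : Set (Param d m H)) (η α lam : ℝ)
    (w₀ : Param d m H) {n : ℕ} (s s' : Fin n → Sample d) (I : ℕ → Finset (Fin n)) (k : ℕ) : ℝ :=
  metricNorm ((1 / 2 : ℝ) • ((state σ ℓ C η α lam w₀ s I k).2 +
      (state σ ℓ C η α lam w₀ s' I k).2))
    (iterate σ ℓ C η α lam w₀ s I k - iterate σ ℓ C η α lam w₀ s' I k)

/-- At `k = 0` the truncated `k - 1` would select `H_0`, while `stateDist` uses `H_{-1} = λ 1`; the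
latter convention lets the recursion start at zero. -/
theorem midpointDist_eq {k : ℕ} (hk : 1 ≤ k) :
    midpointDist σ ℓ C η α lam w₀ s I s' k = stateDist σ ℓ C η α lam w₀ s s' I k := by
  obtain ⟨k, rfl⟩ := Nat.exists_eq_add_of_le' hk
  rfl

theorem stateDist_nonneg (k : ℕ) : 0 ≤ stateDist σ ℓ C η α lam w₀ s s' I k :=
  metricNorm_nonneg _ _

theorem stateDist_zero : stateDist σ ℓ C η α lam w₀ s s' I 0 = 0 := by
  simp [stateDist, iterate, state, metricNorm]

theorem stateDist_sq (hα : 0 < α) (hlam : 0 < lam) (k : ℕ) :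
    stateDist σ ℓ C η α lam w₀ s s' I k ^ 2
      = (matForm (state σ ℓ C η α lam w₀ s I k).2
          (iterate σ ℓ C η α lam w₀ s I k - iterate σ ℓ C η α lam w₀ s' I k)
          (iterate σ ℓ C η α lam w₀ s I k - iterate σ ℓ C η α lam w₀ s' I k)
        + matForm (state σ ℓ C η α lam w₀ s' I k).2
          (iterate σ ℓ C η α lam w₀ s I k - iterate σ ℓ C η α lam w₀ s' I k)
          (iterate σ ℓ C η α lam w₀ s I k - iterate σ ℓ C η α lam w₀ s' I k)) / 2 := by
  have h := fun q v => le_matForm_state (σ := σ) (ℓ := ℓ) (C := C) (η := η) (lam := lam)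
    (w₀ := w₀) (s := q) (I := I) hα k v
  rw [stateDist, metricNorm_sq, matForm_smul, matForm_add]
  · ring
  · rw [matForm_smul, matForm_add]
    have := fun q => (by positivity : (0 : ℝ) ≤ lam * ‖iterate σ ℓ C η α lam w₀ s I k
      - iterate σ ℓ C η α lam w₀ s' I k‖ ^ 2).trans (h q _)
    have := this s
    have := ‹∀ q, _› s'
    linarith

theorem norm_le_stateDist (hα : 0 < α) (hlam : 0 < lam) (k : ℕ) :
    ‖iterate σ ℓ C η α lam w₀ s I k - iterate σ ℓ C η α lam w₀ s' I k‖
      ≤ stateDist σ ℓ C η α lam w₀ s s' I k / √lam := by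
  have h := fun q v => le_matForm_state (σ := σ) (ℓ := ℓ) (C := C) (η := η) (lam := lam)
    (w₀ := w₀) (s := q) (I := I) hα k v
  rw [le_div_iff₀ (Real.sqrt_pos.2 hlam)]
  refine abs_le_of_sq_le_sq' ?_ (stateDist_nonneg k) |>.2
  rw [stateDist_sq hα hlam, mul_pow, Real.sq_sqrt hlam.le]
  have h1 := h s (iterate σ ℓ C η α lam w₀ s I k - iterate σ ℓ C η α lam w₀ s' I k)
  have h2 := h s' (iterate σ ℓ C η α lam w₀ s I k - iterate σ ℓ C η α lam w₀ s' I k)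
  linarith

/-- One step of the stability recursion, for a fixed sequence of minibatches. -/
theorem stateDist_succ_le (hS : IsRegularModel σ C Z ℓ r Lφ Lℓ L Lg ν)
    (hs : ∀ j, s j ∈ Z) (hs' : ∀ j, s' j ∈ Z) {i₀ : Fin n} (hi₀ : ∀ j, j ≠ i₀ → s j = s' j)
    (hw₀ : w₀ ∈ C) {B : ℕ} (hB1 : 1 ≤ B) (hB : ∀ t, (I t).card = B) {ε Λ : ℝ}
    (hη : 0 < η) (hα : 0 < α) (hlam : 0 < lam)
    (hε : ε = B * Lℓ * Lg) (hΛ : Λ = B * L * Lφ ^ 2 + ε) (hηΛ : η / lam ≤ 1 / Λ)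
    (hαη : 2 * α ≤ η * ν) (k : ℕ) {l : ℝ} (hl : 0 < l)
    (hH : ∀ v, l * ‖v‖ ^ 2 ≤ matForm (precond σ ℓ C η α lam w₀ s I k) v v) :
    stateDist σ ℓ C η α lam w₀ s s' I (k + 1) ≤ stateDist σ ℓ C η α lam w₀ s s' I k
      + √(5 * (η * ε) * r ^ 2 + 2 * α * B * Lg ^ 2 * r ^ 4)
      + 3 * (stepError r Lφ Lℓ Lg η α B (fun t => if i₀ ∈ I t then 1 else 0) k / √l) := by
  have hφ := hS.Lφ_pos
  have hg := hS.Lg_nonneg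
  have hr := hS.r_nonneg
  have hℓ := hS.Lℓ_nonneg
  have hε0 : 0 ≤ ε := by rw [hε]; positivity
  have hmem : ∀ q : Fin n → Sample d, ∀ t, iterate σ ℓ C η α lam w₀ q I t ∈ C := fun q t =>
    iterate_mem hS.isCompact hw₀ t
  have hχ : ∀ t, (0 : ℝ) ≤ if i₀ ∈ I t then 1 else 0 := fun t => by split_ifs <;> norm_num
  set D : ℝ := α * ∑ t ∈ Finset.range (k + 1),
    (B * (2 * Lφ * Lg * r) + 2 * Lφ ^ 2 * (if i₀ ∈ I t then 1 else 0)) with hD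
  have hD0 : 0 ≤ D := mul_nonneg hα.le (Finset.sum_nonneg fun t _ =>
    add_nonneg (by positivity) (mul_nonneg (by positivity) (hχ t)))
  have hstep := midpoint_sq_step (I k) i₀ (matForm (state σ ℓ C η α lam w₀ s I k).2)
    (matForm (state σ ℓ C η α lam w₀ s' I k).2) (matForm (state σ ℓ C η α lam w₀ s I (k + 1)).2)
    (matForm (state σ ℓ C η α lam w₀ s' I (k + 1)).2)
    (sampleGrad σ s (iterate σ ℓ C η α lam w₀ s I k))
    -- The intermediate object: gradients of `s` at the iterate of the run on `s'`. Coercivity needs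
    -- a single training set, and the passage to `s'` affects only `i₀`.
    (sampleGrad σ s (iterate σ ℓ C η α lam w₀ s' I k))
    (sampleGrad σ s' (iterate σ ℓ C η α lam w₀ s' I k))
    (iterate σ ℓ C η α lam w₀ s I k) (iterate σ ℓ C η α lam w₀ s' I k)
    (iterate σ ℓ C η α lam w₀ s I (k + 1)) (iterate σ ℓ C η α lam w₀ s' I (k + 1))
    (batchGradient σ ℓ s (I k) (iterate σ ℓ C η α lam w₀ s I k))
    (batchGradient σ ℓ s' (I k) (iterate σ ℓ C η α lam w₀ s' I k)) _
    (q := 2 * Lφ * Lℓ * (if i₀ ∈ I k then 1 else 0)) (D := D) (Lφ := Lφ)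
    hlam hη hα (matForm_state_symm k) (matForm_state_symm k) (le_matForm_state hα k)
    (le_matForm_state hα k) (matForm_state_succ k) (matForm_state_succ k)
    (fun j _ hj => by rw [sampleGrad, sampleGrad, hi₀ j hj])
    (fun j _ => hS.norm_sampleGrad_le hs' (hmem s' k) j)
    (iterate_variational hS.isCompact hS.convex hα hlam k (hmem s' (k + 1)))
    (iterate_variational hS.isCompact hS.convex hα hlam k (hmem s (k + 1)))
    (by
      refine le_of_eq_of_le ?_
        (hS.norm_batchGradient_sub_le hs hs' hi₀ (hmem s' k) (I k))
      simp only [batchGradient_eq, Finset.sum_sub_distrib]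
      congr 1
      abel)
    (abs_matForm_state_sub_le hS hs hs' hi₀ hw₀ hα hB (k + 1))
    (hS.gradient_gap hs (hmem s k) (hmem s' k) (hB k) hB1 hη hα hε hΛ hηΛ hαη)
  rw [← stateDist_sq hα hlam, ← stateDist_sq hα hlam] at hstep
  refine le_add_sqrt_of_sq_le (stateDist_nonneg _) (stateDist_nonneg _) (by positivity) ?_ hl
    (x := ‖iterate σ ℓ C η α lam w₀ s I (k + 1) - iterate σ ℓ C η α lam w₀ s' I (k + 1)‖) ?_
    (hstep.trans ?_)
  · have := hχ k
    rw [stepError]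
    positivity
  · have h1 := hH (iterate σ ℓ C η α lam w₀ s I (k + 1) - iterate σ ℓ C η α lam w₀ s' I (k + 1))
    have h2 := (by positivity : (0 : ℝ) ≤ lam * _).trans
      (le_matForm_state (σ := σ) (ℓ := ℓ) (C := C) (η := η) (lam := lam) (w₀ := w₀) (s := s')
        (I := I) hα (k + 1)
        (iterate σ ℓ C η α lam w₀ s I (k + 1) - iterate σ ℓ C η α lam w₀ s' I (k + 1)))
    rw [stateDist_sq hα hlam]
    rw [precond] at h1
    linarith
  · have hΔ := hS.norm_sub_le_of_mem (hmem s k) (hmem s' k)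
    have hab : ‖iterate σ ℓ C η α lam w₀ s I (k + 1) - iterate σ ℓ C η α lam w₀ s I k
        + (iterate σ ℓ C η α lam w₀ s' I (k + 1) - iterate σ ℓ C η α lam w₀ s' I k)‖ ≤ 2 * r := by
      refine (norm_add_le _ _).trans ?_
      linarith [hS.norm_sub_le_of_mem (hmem s (k + 1)) (hmem s k),
        hS.norm_sub_le_of_mem (hmem s' (k + 1)) (hmem s' k)]
    rw [stepError, ← hD]
    have h1 := hχ k
    have hDr : D / 2 * ‖iterate σ ℓ C η α lam w₀ s I (k + 1) - iterate σ ℓ C η α lam w₀ s I k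
        + (iterate σ ℓ C η α lam w₀ s' I (k + 1) - iterate σ ℓ C η α lam w₀ s' I k)‖ ≤ D * r := by
      calc _ ≤ D / 2 * (2 * r) := by gcongr
        _ = D * r := by ring
    refine add_le_add le_rfl (mul_le_mul_of_nonneg_right (mul_le_mul_of_nonneg_left
      (add_le_add (add_le_add ?_ le_rfl) hDr) zero_le_two) (norm_nonneg _))
    gcongr

end

end SGN

namespace SGN

noncomputable section

/-! ### Uniform minibatches -/

section Batches

variable {Ω : Type*} [MeasurableSpace Ω] {μ : Measure Ω} {n B : ℕ}
  {I : ℕ → Ω → Finset (Fin n)}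

theorem IsUniformBatchProcess.measure_mem (hI : IsUniformBatchProcess μ B I) (t : ℕ)
    {V : Finset (Finset (Fin n))} (hV : ∀ M ∈ V, M.card = B) :
    μ {ω | I t ω ∈ V} = V.card * (n.choose B : ℝ≥0∞)⁻¹ := by
  have h : {ω | I t ω ∈ V} = ⋃ M ∈ V, {ω | I t ω = M} := by ext ω; simp
  rw [h, measure_biUnion_finset (fun M _ N _ hMN => Set.disjoint_left.2 fun ω h1 h2 =>
      hMN (h1.symm.trans h2)) (fun M _ => hI.measurable t M),
    Finset.sum_congr rfl fun M hM => hI.law t M (hV M hM), Finset.sum_const, nsmul_eq_mul]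

/-- The `n.choose B` sets of size `B` already carry total mass one. -/
theorem IsUniformBatchProcess.ae_card [IsProbabilityMeasure μ]
    (hI : IsUniformBatchProcess μ B I) (hBn : B ≤ n) (t : ℕ) :
    ∀ᵐ ω ∂μ, (I t ω).card = B := by
  have hc : (n.choose B : ℝ≥0∞) ≠ 0 := by exact_mod_cast (Nat.choose_pos hBn).ne'
  have h := hI.measure_mem t (V := Finset.powersetCard B Finset.univ)
    fun M hM => (Finset.mem_powersetCard.1 hM).2
  rw [Finset.card_powersetCard, Finset.card_univ, Fintype.card_fin,
    ENNReal.mul_inv_cancel hc (ENNReal.natCast_ne_top _)] at h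
  have hset : {ω | I t ω ∈ Finset.powersetCard B Finset.univ} = {ω | (I t ω).card = B} := by
    ext ω; simp [Finset.mem_powersetCard]
  rw [hset] at h
  have hmeas : MeasurableSet {ω | (I t ω).card = B} := by
    have : {ω | (I t ω).card = B} = ⋃ M : {M : Finset (Fin n) // M.card = B}, {ω | I t ω = M} := by
      ext ω; simp
    rw [this]
    exact MeasurableSet.iUnion fun M => hI.measurable t M
  exact (mem_ae_iff_prob_eq_one hmeas).2 h

/-- A batch containing `i₀` is recovered from what remains after erasing `i₀`. -/
theorem card_filter_mem_powersetCard_le (i₀ : Fin n) :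
    ((Finset.powersetCard B (Finset.univ : Finset (Fin n))).filter (i₀ ∈ ·)).card
      ≤ (n - 1).choose (B - 1) := by
  have hsub : (Finset.powersetCard B (Finset.univ : Finset (Fin n))).filter (i₀ ∈ ·)
      ⊆ (Finset.powersetCard (B - 1) (Finset.univ.erase i₀)).image (insert i₀) := by
    intro M hM
    obtain ⟨h1, h2⟩ := Finset.mem_filter.1 hM
    refine Finset.mem_image.2 ⟨M.erase i₀, Finset.mem_powersetCard.2
      ⟨Finset.erase_subset_erase _ (Finset.subset_univ _), ?_⟩, Finset.insert_erase h2⟩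
    rw [Finset.card_erase_of_mem h2, (Finset.mem_powersetCard.1 h1).2]
  refine (Finset.card_le_card hsub).trans (Finset.card_image_le.trans (le_of_eq ?_))
  rw [Finset.card_powersetCard, Finset.card_erase_of_mem (Finset.mem_univ _), Finset.card_univ,
    Fintype.card_fin]

/-- The probability is a ratio of binomial coefficients, evaluated by `n * (n - 1).choose (B - 1) =
B * n.choose B`. -/
theorem IsUniformBatchProcess.prob_mem_le [IsProbabilityMeasure μ]
    (hI : IsUniformBatchProcess μ B I) (hB : 1 ≤ B)
    (hBn : B ≤ n) (i₀ : Fin n) (t : ℕ) : μ.real {ω | i₀ ∈ I t ω} ≤ B / n := by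
  set V := (Finset.powersetCard B (Finset.univ : Finset (Fin n))).filter (i₀ ∈ ·) with hV
  have h1 : μ {ω | i₀ ∈ I t ω} ≤ μ {ω | I t ω ∈ V} := by
    refine measure_mono_ae ?_
    filter_upwards [hI.ae_card hBn t] with ω hω h
    exact Finset.mem_filter.2 ⟨Finset.mem_powersetCard.2 ⟨Finset.subset_univ _, hω⟩, h⟩
  rw [hI.measure_mem t fun M hM => (Finset.mem_powersetCard.1 (Finset.mem_filter.1 hM).1).2] at h1
  have hc : 0 < n.choose B := Nat.choose_pos hBn
  have hfin : (V.card * (n.choose B : ℝ≥0∞)⁻¹) ≠ ∞ := ENNReal.mul_ne_top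
    (ENNReal.natCast_ne_top _) (ENNReal.inv_ne_top.2 (by exact_mod_cast hc.ne'))
  have h2 := ENNReal.toReal_mono hfin h1
  rw [ENNReal.toReal_mul, ENNReal.toReal_inv, ENNReal.toReal_natCast, ENNReal.toReal_natCast] at h2
  refine h2.trans ?_
  have hn : 0 < n := by omega
  have hcard : V.card * n ≤ B * n.choose B := by
    refine (Nat.mul_le_mul_right n (card_filter_mem_powersetCard_le i₀)).trans (le_of_eq ?_)
    have := Nat.add_one_mul_choose_eq (n - 1) (B - 1)
    rw [Nat.sub_add_cancel hn, Nat.sub_add_cancel hB]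
      at this
    rw [mul_comm, this, mul_comm]
  rw [← div_eq_mul_inv, div_le_div_iff₀ (by exact_mod_cast hc) (by exact_mod_cast hn)]
  exact_mod_cast hcard

/-- A real function of finitely many minibatches is integrable. -/
theorem IsUniformBatchProcess.integrable [IsProbabilityMeasure μ]
    (hI : IsUniformBatchProcess μ B I) (k : ℕ)
    (f : (ℕ → Finset (Fin n)) → ℝ) (hf : ∀ J J', (∀ t < k, J t = J' t) → f J = f J') :
    Integrable (fun ω => f fun t => I t ω) μ := by
  let _ : MeasurableSpace (Finset (Fin n)) := ⊤
  have hsingle : MeasurableSingletonClass (Finset (Fin n)) := ⟨fun _ => trivial⟩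
  -- The value `∅` from time `k` on is arbitrary, since `f` sees only earlier batches. `F` has a
  -- finite domain and is therefore bounded and measurable.
  set F : (Fin k → Finset (Fin n)) → ℝ :=
    fun J => f fun t => if h : t < k then J ⟨t, h⟩ else ∅ with hF
  have hfF : (fun ω => f fun t => I t ω) = F ∘ fun ω (t : Fin k) => I t ω := by
    ext ω
    exact hf _ _ fun t ht => by simp [ht]
  have hmeas : Measurable fun ω (t : Fin k) => I t ω :=
    measurable_pi_iff.2 fun t => measurable_to_countable' fun M => hI.measurable t M
  obtain ⟨b, hb⟩ := (Set.finite_range fun J => ‖F J‖).bddAbove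
  rw [hfF]
  exact Integrable.of_bound ((measurable_of_countable F).comp hmeas).aestronglyMeasurable b
    (ae_of_all _ fun ω => hb ⟨fun t : Fin k => I t ω, rfl⟩)

theorem IsUniformBatchProcess.integrable_indicator [IsProbabilityMeasure μ]
    (hI : IsUniformBatchProcess μ B I)
    (i₀ : Fin n) (t : ℕ) : Integrable (fun ω => if i₀ ∈ I t ω then (1 : ℝ) else 0) μ :=
  hI.integrable (t + 1) (fun J => if i₀ ∈ J t then (1 : ℝ) else 0)
    fun J J' h => by simp only [h t (Nat.lt_succ_self t)]

theorem IsUniformBatchProcess.integral_indicator_le [IsProbabilityMeasure μ]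
    (hI : IsUniformBatchProcess μ B I)
    (hB : 1 ≤ B) (hBn : B ≤ n) (i₀ : Fin n) (t : ℕ) :
    ∫ ω, (if i₀ ∈ I t ω then (1 : ℝ) else 0) ∂μ ≤ B / n := by
  have hmeas : MeasurableSet {ω | i₀ ∈ I t ω} := by
    have : {ω | i₀ ∈ I t ω} = ⋃ M : {M : Finset (Fin n) // i₀ ∈ M}, {ω | I t ω = M} := by
      ext ω; simp
    rw [this]
    exact MeasurableSet.iUnion fun M => hI.measurable t M
  have h : (fun ω => if i₀ ∈ I t ω then (1 : ℝ) else 0) = {ω | i₀ ∈ I t ω}.indicator 1 := by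
    ext ω; simp [Set.indicator_apply]
  rw [h, integral_indicator_one hmeas]
  exact hI.prob_mem_le hB hBn i₀ t

/-- The expected error of one step. -/
theorem IsUniformBatchProcess.integral_stepError_le [IsProbabilityMeasure μ]
    (hI : IsUniformBatchProcess μ B I)
    (hB : 1 ≤ B) (hBn : B ≤ n) (i₀ : Fin n) {r Lφ Lℓ Lg η α : ℝ} (hr : 0 ≤ r) (hLφ : 0 < Lφ)
    (hLℓ : 0 ≤ Lℓ) (hη : 0 < η) (hα : 0 < α) (k : ℕ) :
    Integrable (fun ω => stepError r Lφ Lℓ Lg η α B (fun t => if i₀ ∈ I t ω then 1 else 0) k) μ ∧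
    ∫ ω, stepError r Lφ Lℓ Lg η α B (fun t => if i₀ ∈ I t ω then 1 else 0) k ∂μ
      ≤ stepError r Lφ Lℓ Lg η α B (fun _ => B / n) k := by
  have hint := hI.integrable_indicator i₀
  -- The error is affine in the indicators with nonnegative coefficients, so their means may be
  -- replaced by the bound `B / n`.
  have hlin : ∀ χ : ℕ → ℝ, stepError r Lφ Lℓ Lg η α B χ k
      = α * r * ((k + 1) * (B * (2 * Lφ * Lg * r))) + ((α / 2 * Lφ ^ 2 * r + 2 * η * Lφ * Lℓ) * χ k
        + 2 * α * r * Lφ ^ 2 * ∑ t ∈ Finset.range (k + 1), χ t) := fun χ => by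
    rw [stepError, Finset.sum_add_distrib, Finset.sum_const, Finset.card_range, nsmul_eq_mul,
      ← Finset.mul_sum]
    push_cast
    ring
  have hsum : Integrable (fun ω => ∑ t ∈ Finset.range (k + 1),
      if i₀ ∈ I t ω then (1 : ℝ) else 0) μ := integrable_finsetSum _ fun t _ => hint t
  simp only [hlin]
  have hvar : Integrable (fun ω => (α / 2 * Lφ ^ 2 * r + 2 * η * Lφ * Lℓ)
        * (if i₀ ∈ I k ω then (1 : ℝ) else 0)
      + 2 * α * r * Lφ ^ 2 * ∑ t ∈ Finset.range (k + 1), if i₀ ∈ I t ω then (1 : ℝ) else 0) μ :=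
    ((hint k).const_mul _).add (hsum.const_mul _)
  refine ⟨(integrable_const _).add hvar, ?_⟩
  rw [integral_add (integrable_const _) hvar, integral_const, probReal_univ, one_smul,
    integral_add ((hint k).const_mul _) (hsum.const_mul _), integral_const_mul, integral_const_mul,
    integral_finsetSum _ fun t _ => hint t]
  have h := hI.integral_indicator_le hB hBn i₀
  gcongr with t ht
  · exact h k
  · exact h t

end Batches

end

end SGN

namespace SGN

noncomputable section

variable {d m H : ℕ}

/-! ### The bound -/

theorem stabilityBound_zero (B n : ℕ) (η α Lg : ℝ) (ls : ℕ → ℝ) :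
    stabilityBound B n η α Lg ls 0 = 0 := by
  simp [stabilityBound]

theorem stabilityBound_succ (B n : ℕ) (η α Lg : ℝ) (ls : ℕ → ℝ) (k : ℕ) :
    stabilityBound B n η α Lg ls (k + 1) = stabilityBound B n η α Lg ls k
      + (√(η * B * Lg) + √α * (B : ℝ) ^ (3 / 2 : ℝ) * Lg
        + α * (B : ℝ) ^ 2 * (Lg + 1 / n) * (((k : ℝ) + 1) / √(ls k))
        + η * B / n * (1 / √(ls k))) := by
  rw [stabilityBound, stabilityBound, Finset.sum_range_succ, Finset.sum_range_succ]
  push_cast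
  ring

theorem monotone_stabilityBound {B n : ℕ} {η α Lg : ℝ} (hη : 0 < η) (hα : 0 < α) (hLg : 0 ≤ Lg)
    (ls : ℕ → ℝ) : Monotone (stabilityBound B n η α Lg ls) :=
  monotone_nat_of_le_succ fun k => by
    rw [stabilityBound_succ, le_add_iff_nonneg_right]
    positivity

/-- The constant of the stability theorem. -/
def stabilityConst (r Lφ Lℓ : ℝ) : ℝ :=
  -- The terms after `1` come in turn from the two parts of the coercivity defect, from the
  -- preconditioners and from the changed gradient; the `1` ensures positivity.
  1 + r * √(5 * Lℓ) + 2 * r ^ 2 + 3 * (Lφ ^ 2 * r / 2 + 2 * Lφ * r ^ 2 + 2 * Lφ ^ 2 * r)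
    + 6 * (Lφ * Lℓ)

theorem stabilityConst_pos {r Lφ Lℓ : ℝ} (hr : 0 ≤ r) (hLφ : 0 < Lφ) (hLℓ : 0 ≤ Lℓ) :
    0 < stabilityConst r Lφ Lℓ := by
  rw [stabilityConst]; positivity

/-- Subadditivity of the square root, with the slack `2B ≤ 4B³` in the second term. -/
theorem sqrt_defect_le {r Lℓ Lg η α ε : ℝ} {B : ℕ} (hr : 0 ≤ r) (hLℓ : 0 ≤ Lℓ) (hLg : 0 ≤ Lg)
    (hη : 0 < η) (hα : 0 < α) (hB : 1 ≤ B) (hε : ε = B * Lℓ * Lg) :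
    √(5 * (η * ε) * r ^ 2 + 2 * α * B * Lg ^ 2 * r ^ 4)
      ≤ r * √(5 * Lℓ) * √(η * B * Lg) + 2 * r ^ 2 * (√α * (B : ℝ) ^ (3 / 2 : ℝ) * Lg) := by
  have hB' : (1 : ℝ) ≤ B := by exact_mod_cast hB
  have h1 : √(5 * Lℓ) ^ 2 = 5 * Lℓ := Real.sq_sqrt (by positivity)
  have h2 : √(η * B * Lg) ^ 2 = η * B * Lg := Real.sq_sqrt (by positivity)
  have h3 : √α ^ 2 = α := Real.sq_sqrt hα.le
  have h4 : ((B : ℝ) ^ (3 / 2 : ℝ)) ^ 2 = (B : ℝ) ^ 3 := by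
    rw [← Real.rpow_natCast, ← Real.rpow_mul (by positivity), ← Real.rpow_natCast]
    norm_num
  have h5 : (B : ℝ) ≤ (B : ℝ) ^ 3 := le_self_pow₀ hB' (by norm_num)
  refine Real.sqrt_le_iff.2 ⟨by positivity, ?_⟩
  have e1 : (r * √(5 * Lℓ) * √(η * B * Lg)) ^ 2 = 5 * (η * ε) * r ^ 2 := by
    rw [mul_pow, mul_pow, h1, h2, hε]; ring
  have e2 : (2 * r ^ 2 * (√α * (B : ℝ) ^ (3 / 2 : ℝ) * Lg)) ^ 2
      = 4 * α * (B : ℝ) ^ 3 * Lg ^ 2 * r ^ 4 := by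
    simp only [mul_pow, h3, h4]
    ring
  have e3 : 0 ≤ (r * √(5 * Lℓ) * √(η * B * Lg)) * (2 * r ^ 2 * (√α * (B : ℝ) ^ (3 / 2 : ℝ) * Lg)) := by
    positivity
  have e4 : 2 * α * B * Lg ^ 2 * r ^ 4 ≤ 4 * α * (B : ℝ) ^ 3 * Lg ^ 2 * r ^ 4 := by
    gcongr
    norm_num
  rw [add_sq, e1, e2]
  linarith

/-- The three contributions with factor `α` are of sizes `B/n`, `B Lg (k + 1)` and `(B/n)(k + 1)`;
each is absorbed by `B² (Lg + 1/n) (k + 1)`. -/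
theorem stepError_const_le {r Lφ Lℓ Lg η α : ℝ} {B n : ℕ} (hr : 0 ≤ r) (hLφ : 0 < Lφ)
    (hLg : 0 ≤ Lg) (hα : 0 < α) (hB : 1 ≤ B) (k : ℕ) :
    stepError r Lφ Lℓ Lg η α B (fun _ => B / n) k
      ≤ (Lφ ^ 2 * r / 2 + 2 * Lφ * r ^ 2 + 2 * Lφ ^ 2 * r)
          * (α * (B : ℝ) ^ 2 * (Lg + 1 / n) * ((k : ℝ) + 1))
        + 2 * (Lφ * Lℓ) * (η * B / n) := by
  have hB' : (1 : ℝ) ≤ B := by exact_mod_cast hB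
  have hBB : (B : ℝ) ≤ (B : ℝ) ^ 2 := le_self_pow₀ hB' (by norm_num)
  have hn : (0 : ℝ) ≤ 1 / n := by positivity
  rw [stepError, Finset.sum_const, Finset.card_range, nsmul_eq_mul, div_eq_mul_one_div (B : ℝ),
    div_eq_mul_one_div (η * B)]
  generalize (1 : ℝ) / n = c at hn
  push_cast
  have hk : (1 : ℝ) ≤ (k : ℝ) + 1 := by linarith [Nat.cast_nonneg (α := ℝ) k]
  generalize (k : ℝ) + 1 = q at hk
  have h0 : α * B * c ≤ α * (B : ℝ) ^ 2 * (Lg + c) * q := by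
    calc α * B * c ≤ α * (B : ℝ) ^ 2 * (Lg + c) := by gcongr; linarith
      _ ≤ _ := le_mul_of_one_le_right (by positivity) hk
  have h1 : α * B * Lg * q ≤ α * (B : ℝ) ^ 2 * (Lg + c) * q := by gcongr; linarith
  have h2 : α * B * c * q ≤ α * (B : ℝ) ^ 2 * (Lg + c) * q := by gcongr; linarith
  have e0 := mul_le_mul_of_nonneg_left h0 (by positivity : 0 ≤ Lφ ^ 2 * r / 2)
  have e1 := mul_le_mul_of_nonneg_left h1 (by positivity : 0 ≤ 2 * Lφ * r ^ 2)
  have e2 := mul_le_mul_of_nonneg_left h2 (by positivity : 0 ≤ 2 * Lφ ^ 2 * r)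
  linarith

/-- The expected increment of one step is at most the constant times the increment of the bound. -/
theorem increment_le {r Lφ Lℓ Lg η α ε l : ℝ} {B n : ℕ} (hr : 0 ≤ r) (hLφ : 0 < Lφ)
    (hLℓ : 0 ≤ Lℓ) (hLg : 0 ≤ Lg) (hη : 0 < η) (hα : 0 < α) (hB : 1 ≤ B)
    (hε : ε = B * Lℓ * Lg) (k : ℕ) :
    √(5 * (η * ε) * r ^ 2 + 2 * α * B * Lg ^ 2 * r ^ 4)
        + 3 * (stepError r Lφ Lℓ Lg η α B (fun _ => B / n) k / √l)
      ≤ stabilityConst r Lφ Lℓ * (√(η * B * Lg) + √α * (B : ℝ) ^ (3 / 2 : ℝ) * Lg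
        + α * (B : ℝ) ^ 2 * (Lg + 1 / n) * (((k : ℝ) + 1) / √l) + η * B / n * (1 / √l)) := by
  have h1 := sqrt_defect_le hr hLℓ hLg hη hα hB hε
  have h2 := div_le_div_of_nonneg_right
    (stepError_const_le (n := n) (Lℓ := Lℓ) (η := η) hr hLφ hLg hα hB k) (Real.sqrt_nonneg l)
  have e2 : ((Lφ ^ 2 * r / 2 + 2 * Lφ * r ^ 2 + 2 * Lφ ^ 2 * r)
          * (α * (B : ℝ) ^ 2 * (Lg + 1 / n) * ((k : ℝ) + 1))
        + 2 * (Lφ * Lℓ) * (η * B / n)) / √l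
      = (Lφ ^ 2 * r / 2 + 2 * Lφ * r ^ 2 + 2 * Lφ ^ 2 * r)
          * (α * (B : ℝ) ^ 2 * (Lg + 1 / n) * (((k : ℝ) + 1) / √l))
        + 2 * (Lφ * Lℓ) * (η * B / n * (1 / √l)) := by ring
  rw [e2] at h2
  have p1 : 0 ≤ √(η * B * Lg) := by positivity
  have p2 : 0 ≤ √α * (B : ℝ) ^ (3 / 2 : ℝ) * Lg := by positivity
  have p3 : 0 ≤ α * (B : ℝ) ^ 2 * (Lg + 1 / n) * (((k : ℝ) + 1) / √l) := by positivity
  have p4 : 0 ≤ η * B / n * (1 / √l) := by positivity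
  have q1 : 0 ≤ r * √(5 * Lℓ) := by positivity
  have q2 : 0 ≤ 2 * r ^ 2 := by positivity
  have q3 : 0 ≤ 3 * (Lφ ^ 2 * r / 2 + 2 * Lφ * r ^ 2 + 2 * Lφ ^ 2 * r) := by positivity
  have q4 : 0 ≤ 6 * (Lφ * Lℓ) := by positivity
  have k1 : r * √(5 * Lℓ) ≤ stabilityConst r Lφ Lℓ := by rw [stabilityConst]; linarith
  have k2 : 2 * r ^ 2 ≤ stabilityConst r Lφ Lℓ := by rw [stabilityConst]; linarith
  have k3 : 3 * (Lφ ^ 2 * r / 2 + 2 * Lφ * r ^ 2 + 2 * Lφ ^ 2 * r) ≤ stabilityConst r Lφ Lℓ := by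
    rw [stabilityConst]; linarith
  have k4 : 6 * (Lφ * Lℓ) ≤ stabilityConst r Lφ Lℓ := by rw [stabilityConst]; linarith
  have m1 := mul_le_mul_of_nonneg_right k1 p1
  have m2 := mul_le_mul_of_nonneg_right k2 p2
  have m3 := mul_le_mul_of_nonneg_right k3 p3
  have m4 := mul_le_mul_of_nonneg_right k4 p4
  linarith

/-! ### Dependence on the minibatches -/

variable {σ : ℝ → ℝ} {C : Set (Param d m H)} {Z : Set (Sample d)}
  {ℓ : ℝ → Sample d → ℝ} {r Lφ Lℓ L Lg ν : ℝ} {n : ℕ} {s s' : Fin n → Sample d}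
  {η α lam : ℝ} {w₀ : Param d m H}

/-- The state at time `k` is a function of finitely many batches, which is what makes all
expectations below well defined. -/
theorem state_congr (s : Fin n → Sample d) {I I' : ℕ → Finset (Fin n)} {k : ℕ}
    (h : ∀ t < k, I t = I' t) :
    state σ ℓ C η α lam w₀ s I k = state σ ℓ C η α lam w₀ s I' k := by
  induction k with
  | zero => rfl
  | succ k ih =>
    simp only [state]
    rw [ih fun t ht => h t (ht.trans (Nat.lt_succ_self k)), h k (Nat.lt_succ_self k)]

theorem stateDist_congr {I I' : ℕ → Finset (Fin n)} {k : ℕ} (h : ∀ t < k, I t = I' t) :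
    stateDist σ ℓ C η α lam w₀ s s' I k = stateDist σ ℓ C η α lam w₀ s s' I' k := by
  simp only [stateDist, iterate, state_congr s h, state_congr s' h]

theorem avgIterate_congr (s : Fin n → Sample d) {I I' : ℕ → Finset (Fin n)} {k : ℕ}
    (h : ∀ t < k, I t = I' t) :
    avgIterate σ ℓ C η α lam w₀ s I k = avgIterate σ ℓ C η α lam w₀ s I' k := by
  rw [avgIterate, avgIterate]
  congr 1
  refine Finset.sum_congr rfl fun t ht => ?_
  rw [iterate, iterate, state_congr s fun u hu => h u (hu.trans (Finset.mem_range.1 ht))]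

theorem avgIterate_mem (hC : IsCompact C) (hconv : Convex ℝ C) (hw₀ : w₀ ∈ C)
    (I : ℕ → Finset (Fin n)) {k : ℕ} (hk : 1 ≤ k) : avgIterate σ ℓ C η α lam w₀ s I k ∈ C := by
  have hk0 : (k : ℝ) ≠ 0 := by exact_mod_cast (by omega : k ≠ 0)
  rw [avgIterate, Finset.smul_sum]
  exact hconv.sum_mem (fun _ _ => by positivity) (by simp [hk0]) fun t _ => iterate_mem hC hw₀ t

theorem norm_avgIterate_sub_le (hα : 0 < α) (hlam : 0 < lam) (I : ℕ → Finset (Fin n)) (k : ℕ) :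
    ‖avgIterate σ ℓ C η α lam w₀ s I k - avgIterate σ ℓ C η α lam w₀ s' I k‖
      ≤ 1 / k * ∑ t ∈ Finset.range k, stateDist σ ℓ C η α lam w₀ s s' I t / √lam := by
  rw [avgIterate, avgIterate, ← smul_sub, ← Finset.sum_sub_distrib, norm_smul, Real.norm_eq_abs,
    abs_of_nonneg (by positivity)]
  refine mul_le_mul_of_nonneg_left ?_ (by positivity)
  exact (norm_sum_le _ _).trans (Finset.sum_le_sum fun t _ => norm_le_stateDist hα hlam t)

/-- The loss gap of the averaged iterates. -/
theorem IsRegularModel.abs_loss_avgIterate_sub_le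
    (hS : IsRegularModel σ C Z ℓ r Lφ Lℓ L Lg ν) (hw₀ : w₀ ∈ C) (hα : 0 < α) (hlam : 0 < lam)
    (I : ℕ → Finset (Fin n)) {k : ℕ} (hk : 1 ≤ k) {z : Sample d} (hz : z ∈ Z) :
    |ℓ (predictor σ z.1 (avgIterate σ ℓ C η α lam w₀ s I k)) z
        - ℓ (predictor σ z.1 (avgIterate σ ℓ C η α lam w₀ s' I k)) z|
      ≤ Lℓ * Lφ / √lam * (1 / k * ∑ t ∈ Finset.range k, stateDist σ ℓ C η α lam w₀ s s' I t) := by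
  have hℓ := hS.Lℓ_nonneg
  have hφ := hS.Lφ_pos
  have hw := avgIterate_mem (σ := σ) (ℓ := ℓ) (η := η) (α := α) (lam := lam) (s := s)
    hS.isCompact hS.convex hw₀ I hk
  have hw' := avgIterate_mem (σ := σ) (ℓ := ℓ) (η := η) (α := α) (lam := lam) (s := s')
    hS.isCompact hS.convex hw₀ I hk
  have hx := hS.norm_le z hz
  refine (hS.loss.abs_sub_le hz (R := predictionRange σ C) Set.ordConnected_Icc
    (hS.slope_le z hz) (predictor_mem_range hS.contDiff hS.isCompact hx hw)
    (predictor_mem_range hS.contDiff hS.isCompact hx hw')).trans ?_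
  calc _ ≤ Lℓ * (Lφ * (1 / k * ∑ t ∈ Finset.range k,
        stateDist σ ℓ C η α lam w₀ s s' I t / √lam)) := by
        refine mul_le_mul_of_nonneg_left ?_ hℓ
        exact (abs_predictor_sub_le hS.contDiff hS.convex (hS.grad_le _ hx) hw hw').trans
          (mul_le_mul_of_nonneg_left (norm_avgIterate_sub_le hα hlam I k) hφ.le)
    _ = _ := by rw [← Finset.sum_div]; ring

/-! ### Stability -/

theorem le_matForm_of_posSemidef {M : Matrix (ParamIdx d m H) (ParamIdx d m H) ℝ} {l : ℝ}
    (h : (M - l • (1 : Matrix (ParamIdx d m H) (ParamIdx d m H) ℝ)).PosSemidef)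
    (v : Param d m H) : l * ‖v‖ ^ 2 ≤ matForm M v v := by
  have h1 : 0 ≤ matForm (M - l • 1) v v := h.dotProduct_mulVec_nonneg v.ofLp
  have h2 := matForm_add (M - l • 1) (l • 1) v v
  rw [sub_add_cancel, matForm_smul, matForm_one, real_inner_self_eq_norm_sq] at h2
  linarith

/-- The spectral lower bound `μ₀` of the Gram matrix is at most the gradient bound. -/
theorem IsRegularModel.sq_le_of_gram (hS : IsRegularModel σ C Z ℓ r Lφ Lℓ L Lg ν)
    (hs : ∀ j, s j ∈ Z) {w : Param d m H} (hw : w ∈ C) (j : Fin n) {μ₀ : ℝ}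
    (h : (jacobian σ s w * (jacobian σ s w)ᵀ
      - μ₀ ^ 2 • (1 : Matrix (Fin n) (Fin n) ℝ)).PosSemidef) : μ₀ ^ 2 ≤ Lφ ^ 2 := by
  have h1 := h.diag_nonneg (i := j)
  have h2 : (jacobian σ s w * (jacobian σ s w)ᵀ) j j = ‖sampleGrad σ s w j‖ ^ 2 := by
    rw [← real_inner_self_eq_norm_sq, ← dotProduct_eq_inner]; rfl
  rw [Matrix.sub_apply, h2, Matrix.smul_apply, Matrix.one_apply_eq, smul_eq_mul, mul_one] at h1
  have h3 := pow_le_pow_left₀ (norm_nonneg _) (hS.norm_sampleGrad_le hs hw j) 2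
  linarith

/-- Both bounds apply to the second derivative of the loss at any prediction in the range. -/
theorem IsRegularModel.ν_le (hS : IsRegularModel σ C Z ℓ r Lφ Lℓ L Lg ν) {z : Sample d}
    (hz : z ∈ Z) {w : Param d m H} (hw : w ∈ C) : ν ≤ L :=
  (hS.loss.le_deriv_deriv hz _).trans
    (hS.curvature_le z hz _ (predictor_mem_range hS.contDiff hS.isCompact (hS.norm_le z hz) hw))

/-- The step size condition bounds `α` by a multiple of `η ν`. -/
theorem two_mul_le_of_step_condition {η α μ₀ ν L Lφ ε Λ : ℝ} {B : ℕ} (hB : 1 ≤ B) (hη : 0 < η)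
    (hμ₀ : 0 < μ₀) (hν : 0 < ν) (hε : 0 ≤ ε) (hΛ : Λ = B * L * Lφ ^ 2 + ε)
    (hμφ : μ₀ ^ 2 ≤ Lφ ^ 2) (hνL : ν ≤ L)
    (h : α / η ≤ μ₀ ^ 2 * ν ^ 2 / (8 * B * (Λ + ε))) : 2 * α ≤ η * ν := by
  have hB' : (1 : ℝ) ≤ B := by exact_mod_cast hB
  have h1 : ν * μ₀ ^ 2 ≤ Λ + ε := by
    calc ν * μ₀ ^ 2 ≤ L * Lφ ^ 2 := mul_le_mul hνL hμφ (sq_nonneg _) (hν.le.trans hνL)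
      _ = 1 * (L * Lφ ^ 2) := by ring
      _ ≤ B * (L * Lφ ^ 2) := mul_le_mul_of_nonneg_right hB'
          (mul_nonneg (hν.le.trans hνL) (sq_nonneg _))
      _ ≤ Λ + ε := by rw [hΛ]; linarith
  have hpos : 0 < ν * μ₀ ^ 2 := by positivity
  -- By `h1` and `1 ≤ B` the left side is at most `ν / 8`; coercivity only requires `ν / 2`.
  have h2 : μ₀ ^ 2 * ν ^ 2 / (8 * B * (Λ + ε)) ≤ ν / 2 := by
    rw [div_le_div_iff₀ (by nlinarith) two_pos]
    have h3 : 1 * (ν * μ₀ ^ 2) ≤ B * (Λ + ε) := mul_le_mul hB' h1 hpos.le (by linarith)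
    have h4 := mul_le_mul_of_nonneg_left h3 hν.le
    have h5 : 0 < ν * (ν * μ₀ ^ 2) := mul_pos hν hpos
    nlinarith
  have h3 := h.trans h2
  rw [div_le_iff₀ hη] at h3
  linarith

/-- The expected distance of the two runs. -/
theorem IsRegularModel.integral_stateDist_le (hS : IsRegularModel σ C Z ℓ r Lφ Lℓ L Lg ν)
    (hs : ∀ j, s j ∈ Z) (hs' : ∀ j, s' j ∈ Z) {i₀ : Fin n} (hi₀ : ∀ j, j ≠ i₀ → s j = s' j)
    (hw₀ : w₀ ∈ C) {B : ℕ} (hB1 : 1 ≤ B) (hBn : B ≤ n) {ε Λ : ℝ}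
    (hη : 0 < η) (hα : 0 < α) (hlam : 0 < lam)
    (hε : ε = B * Lℓ * Lg) (hΛ : Λ = B * L * Lφ ^ 2 + ε) (hηΛ : η / lam ≤ 1 / Λ)
    (hαη : 2 * α ≤ η * ν) {Ω : Type*} [MeasurableSpace Ω] {μ : Measure Ω} [IsProbabilityMeasure μ]
    {I : ℕ → Ω → Finset (Fin n)} (hI : IsUniformBatchProcess μ B I) {ls : ℕ → ℝ}
    (hls : ∀ t, 0 < ls t)
    (hH : ∀ t, ∀ᵐ ω ∂μ, (precond σ ℓ C η α lam w₀ s (fun i => I i ω) t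
      - ls t • (1 : Matrix (ParamIdx d m H) (ParamIdx d m H) ℝ)).PosSemidef) (k : ℕ) :
    Integrable (fun ω => stateDist σ ℓ C η α lam w₀ s s' (fun i => I i ω) k) μ ∧
      ∫ ω, stateDist σ ℓ C η α lam w₀ s s' (fun i => I i ω) k ∂μ
        ≤ stabilityConst r Lφ Lℓ * stabilityBound B n η α Lg ls k := by
  have hint : ∀ k, Integrable (fun ω => stateDist σ ℓ C η α lam w₀ s s' (fun i => I i ω) k) μ :=
    fun k => hI.integrable k (fun J => stateDist σ ℓ C η α lam w₀ s s' J k)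
      fun J J' h => stateDist_congr h
  refine ⟨hint k, ?_⟩
  induction k with
  | zero => simp [stateDist_zero, stabilityBound_zero]
  | succ k ih =>
    obtain ⟨herr, herr_le⟩ := hI.integral_stepError_le hB1 hBn i₀ hS.r_nonneg hS.Lφ_pos
      hS.Lℓ_nonneg hη hα k (Lg := Lg)
    have hstep : ∀ᵐ ω ∂μ, stateDist σ ℓ C η α lam w₀ s s' (fun i => I i ω) (k + 1)
        ≤ stateDist σ ℓ C η α lam w₀ s s' (fun i => I i ω) k
          + √(5 * (η * ε) * r ^ 2 + 2 * α * B * Lg ^ 2 * r ^ 4)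
          + 3 * (stepError r Lφ Lℓ Lg η α B (fun t => if i₀ ∈ I t ω then 1 else 0) k
            / √(ls k)) := by
      -- The pathwise recursion needs all batch sizes up to time `k`, because the preconditioners
      -- remember every earlier batch.
      filter_upwards [hH k, ae_all_iff.2 fun t => hI.ae_card hBn t] with ω h1 h2
      exact stateDist_succ_le hS hs hs' hi₀ hw₀ hB1 h2 hη hα hlam hε hΛ hηΛ hαη k (hls k)
        (le_matForm_of_posSemidef h1)
    have hint1 := (hint k).add (integrable_const
      √(5 * (η * ε) * r ^ 2 + 2 * α * B * Lg ^ 2 * r ^ 4))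
    have hint2 := (herr.div_const √(ls k)).const_mul 3
    have h := integral_mono_ae (hint (k + 1)) (hint1.add hint2) hstep
    have hsum : ∫ ω, (stateDist σ ℓ C η α lam w₀ s s' (fun i => I i ω) k
          + √(5 * (η * ε) * r ^ 2 + 2 * α * B * Lg ^ 2 * r ^ 4)
          + 3 * (stepError r Lφ Lℓ Lg η α B (fun t => if i₀ ∈ I t ω then 1 else 0) k
            / √(ls k))) ∂μ
        = ∫ ω, stateDist σ ℓ C η α lam w₀ s s' (fun i => I i ω) k ∂μ
          + √(5 * (η * ε) * r ^ 2 + 2 * α * B * Lg ^ 2 * r ^ 4)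
          + 3 * ((∫ ω, stepError r Lφ Lℓ Lg η α B (fun t => if i₀ ∈ I t ω then 1 else 0) k ∂μ)
            / √(ls k)) := by
      refine (integral_add hint1 hint2).trans ?_
      rw [integral_const_mul, integral_div]
      congr 1
      refine (integral_add (hint k) (integrable_const _)).trans ?_
      simp
    have h' := h.trans_eq hsum
    have hdiv := div_le_div_of_nonneg_right herr_le (Real.sqrt_nonneg (ls k))
    have hinc := increment_le (n := n) (l := ls k) hS.r_nonneg hS.Lφ_pos hS.Lℓ_nonneg hS.Lg_nonneg
      hη hα hB1 hε k
    rw [stabilityBound_succ, mul_add]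
    linarith

end

end SGN

/-! ### Assembly of the stability theorem -/

theorem theorem2 (r Lφ Lℓ L μ₀ ν : ℝ) (hr : 0 ≤ r) (hLφ : 0 < Lφ) (hLℓ : 0 ≤ Lℓ) (hL : 0 < L)
    (hμ₀ : 0 < μ₀) (hν : 0 < ν) :
    ∃ K : ℝ, 0 < K ∧
      ∀ (d m H n B : ℕ) (_ : 1 ≤ H) (_ : 1 ≤ B) (_ : B ≤ n)
        -- the network
        (σ : ℝ → ℝ) (_ : ContDiff ℝ 2 σ)
        -- the parameter set
        (C : Set (SGN.Param d m H)) (_ : IsCompact C) (_ : Convex ℝ C) (_ : Metric.diam C ≤ r)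
        -- the sample space and the loss
        (Z : Set (SGN.Sample d)) (_ : ∀ z ∈ Z, ‖z.1‖ ≤ 1 ∧ |z.2| ≤ 1)
        (ℓ : ℝ → SGN.Sample d → ℝ) (_ : SGN.IsRegularLoss ℓ Z ν)
        (_ : ∀ z ∈ Z, ∀ y ∈ SGN.predictionRange σ C, |deriv (fun u => ℓ u z) y| ≤ Lℓ)
        (_ : ∀ z ∈ Z, ∀ y ∈ SGN.predictionRange σ C, deriv (deriv fun u => ℓ u z) y ≤ L)
        -- Lipschitz constants of the predictor and of its gradient
        (_ : ∀ x : EuclideanSpace ℝ (Fin d), ‖x‖ ≤ 1 → ∀ w ∈ C,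
          ‖gradient (SGN.predictor σ x) w‖ ≤ Lφ)
        (Lg : ℝ) (_ : 0 ≤ Lg)
        (_ : ∀ x : EuclideanSpace ℝ (Fin d), ‖x‖ ≤ 1 → ∀ w ∈ C, ∀ w' ∈ C,
          ‖gradient (SGN.predictor σ x) w - gradient (SGN.predictor σ x) w'‖ ≤ Lg * ‖w - w'‖)
        -- two training sets at Hamming distance one
        (s s' : Fin n → SGN.Sample d) (_ : ∀ j, s j ∈ Z) (_ : ∀ j, s' j ∈ Z)
        (_ : ∃! j, s j ≠ s' j)
        -- `J(w) J(w)ᵀ ⪰ μ₀² 1` on `C`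
        (_ : ∀ w ∈ C, (SGN.jacobian σ s w * (SGN.jacobian σ s w)ᵀ
          - μ₀ ^ 2 • (1 : Matrix (Fin n) (Fin n) ℝ)).PosSemidef)
        -- the hyperparameters
        (η α lam ε Λ : ℝ) (_ : 0 < η) (_ : 0 < α) (_ : 0 < lam)
        (_ : ε = B * Lℓ * Lg) (_ : Λ = B * L * Lφ ^ 2 + ε)
        (_ : η / lam ≤ 1 / Λ) (_ : α / η ≤ μ₀ ^ 2 * ν ^ 2 / (8 * B * (Λ + ε)))
        -- the starting point and the minibatches
        (w₀ : SGN.Param d m H) (_ : w₀ ∈ C)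
        (Ω : Type*) [MeasurableSpace Ω] (μ : Measure Ω) [IsProbabilityMeasure μ]
        (I : ℕ → Ω → Finset (Fin n)) (_ : SGN.IsUniformBatchProcess μ B I)
        -- `H_t ⪰ ls t` for all `t`
        (ls : ℕ → ℝ) (_ : ∀ t, 0 < ls t)
        (_ : ∀ t, ∀ᵐ ω ∂μ, (SGN.precond σ ℓ C η α lam w₀ s (fun i => I i ω) t
          - ls t • (1 : Matrix (SGN.ParamIdx d m H) (SGN.ParamIdx d m H) ℝ)).PosSemidef)
        (k : ℕ) (_ : 1 ≤ k),
        (Integrable (fun ω => SGN.midpointDist σ ℓ C η α lam w₀ s (fun i => I i ω) s' k) μ ∧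
          ∫ ω, SGN.midpointDist σ ℓ C η α lam w₀ s (fun i => I i ω) s' k ∂μ
            ≤ K * SGN.stabilityBound B n η α Lg ls k) ∧
        ∀ z ∈ Z,
          Integrable (fun ω =>
            |ℓ (SGN.predictor σ z.1 (SGN.avgIterate σ ℓ C η α lam w₀ s (fun i => I i ω) k)) z
              - ℓ (SGN.predictor σ z.1
                  (SGN.avgIterate σ ℓ C η α lam w₀ s' (fun i => I i ω) k)) z|) μ ∧
          ∫ ω, |ℓ (SGN.predictor σ z.1
                  (SGN.avgIterate σ ℓ C η α lam w₀ s (fun i => I i ω) k)) z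
              - ℓ (SGN.predictor σ z.1
                  (SGN.avgIterate σ ℓ C η α lam w₀ s' (fun i => I i ω) k)) z| ∂μ
            ≤ Lℓ * Lφ / √lam * (K * SGN.stabilityBound B n η α Lg ls k) := by
  refine ⟨SGN.stabilityConst r Lφ Lℓ, SGN.stabilityConst_pos hr hLφ hLℓ, ?_⟩
  intro d m H n B _ hB1 hBn σ hσ C hC hconv hdiam Z hZ ℓ hloss hslope hcurv hgrad Lg hLg hlip s s'
    hs hs' hdiff hgram η α lam ε Λ hη hα hlam hε hΛ hηΛ hαη w₀ hw₀ Ω _ μ _ I hI ls hls hH k hk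
  have hS : SGN.IsRegularModel σ C Z ℓ r Lφ Lℓ L Lg ν :=
    ⟨hσ, hC, hconv, hdiam, fun z hz => (hZ z hz).1, hloss, hslope, hcurv, hgrad, hlip, hr, hLφ,
      hLℓ, hL, hLg, hν⟩
  obtain ⟨i₀, -, huniq⟩ := hdiff
  have hi₀ : ∀ j, j ≠ i₀ → s j = s' j := fun j hj => by
    by_contra h
    exact hj (huniq j h)
  have hε0 : 0 ≤ ε := by rw [hε]; positivity
  -- The Gram condition enters through one diagonal entry at `w₀`, which gives `μ₀² ≤ Lφ²`.
  have hαη' : 2 * α ≤ η * ν := SGN.two_mul_le_of_step_condition hB1 hη hμ₀ hν hε0 hΛ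
    (hS.sq_le_of_gram hs hw₀ i₀ (hgram w₀ hw₀)) (hS.ν_le (hs i₀) hw₀) hαη
  have hdist := hS.integral_stateDist_le hs hs' hi₀ hw₀ hB1 hBn hη hα hlam hε hΛ hηΛ hαη' hI hls hH
  refine ⟨?_, fun z hz => ?_⟩
  · simp only [SGN.midpointDist_eq hk]
    exact hdist k
  have hint : Integrable (fun ω =>
      |ℓ (SGN.predictor σ z.1 (SGN.avgIterate σ ℓ C η α lam w₀ s (fun i => I i ω) k)) z
        - ℓ (SGN.predictor σ z.1
            (SGN.avgIterate σ ℓ C η α lam w₀ s' (fun i => I i ω) k)) z|) μ :=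
    hI.integrable k (fun J => |ℓ (SGN.predictor σ z.1 (SGN.avgIterate σ ℓ C η α lam w₀ s J k)) z
        - ℓ (SGN.predictor σ z.1 (SGN.avgIterate σ ℓ C η α lam w₀ s' J k)) z|)
      fun J J' h => by simp only [SGN.avgIterate_congr s h, SGN.avgIterate_congr s' h]
  refine ⟨hint, ?_⟩
  have hsum : Integrable (fun ω => ∑ t ∈ Finset.range k,
      SGN.stateDist σ ℓ C η α lam w₀ s s' (fun i => I i ω) t) μ :=
    integrable_finsetSum _ fun t _ => (hdist t).1
  refine (integral_mono hint ((hsum.const_mul (1 / (k : ℝ))).const_mul (Lℓ * Lφ / √lam))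
    fun ω => hS.abs_loss_avgIterate_sub_le hw₀ hα hlam (fun i => I i ω) hk hz).trans ?_
  rw [integral_const_mul, integral_const_mul, integral_finsetSum _ fun t _ => (hdist t).1]
  refine mul_le_mul_of_nonneg_left ?_ (by positivity)
  have hk0 : (0 : ℝ) < k := by exact_mod_cast hk
  rw [one_div, inv_mul_le_iff₀ hk0]
  -- Each distance in the average, including the zero distance at `t = 0`, is bounded by the last
  -- value of the monotone bound.
  calc _ ≤ ∑ _t ∈ Finset.range k,
        SGN.stabilityConst r Lφ Lℓ * SGN.stabilityBound B n η α Lg ls k :=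
        Finset.sum_le_sum fun t ht => (hdist t).2.trans (mul_le_mul_of_nonneg_left
          (SGN.monotone_stabilityBound hη hα hLg ls (Finset.mem_range.1 ht).le)
          (SGN.stabilityConst_pos hr hLφ hLℓ).le)
    _ = _ := by rw [Finset.sum_const, Finset.card_range, nsmul_eq_mul]
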